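/- Let $d$ be a nonnegative integer, let $\gamma_d$ be the standard Gaussian measure on $\mathbb{R}^d$, and let $\varepsilon>0$. Let $R^\varepsilon$ be the law of $(X,\ e^{-\varepsilon/2}X+\sqrt{1-e^{-\varepsilon}}\,Y)$, where $X,Y$ are independent standard Gaussian vectors in $\mathbb{R}^d$. For probability measures $\alpha,\beta$ put $H(\alpha|\beta)=\int\log\frac{d\alpha}{d\beta}\,d\alpha$ if $\alpha\ll\beta$ and $H(\alpha|\beta)=+\infty$ otherwise. For probability measures $\mu,\nu$ on $\mathbb{R}^d$ let $\Pi(\mu,\nu)$ be the set of couplings of $\mu$ and $\nu$, and let \[ \mathcal{T}_H^\varepsilon(\mu,\nu)=\inf_{\pi\in\Pi(\mu,\nu)}H(\pi|R^\varepsilon). \] Theorem. Let $V,W:\mathbb{R}^d\to\mathbb{R}\cup\{+\infty\}$ be convex functions, with $V$ bounded from below. Let $\mu(dx)=e^{V(x)}\gamma_d(dx)$ be a probability measure with finite second moment, and let $\nu(dx)=e^{-W(x)}\gamma_d(dx)$ be a compactly supported probability measure. Then there is a unique coupling $\pi^\varepsilon\in\Pi(\mu,\nu)$ with $H(\pi^\varepsilon|R^\varepsilon)=\mathcal{T}_H^\varepsilon(\mu,\nu)$,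 and there are a measurable log-convex function $f^\varepsilon:\mathbb{R}^d\to[1,+\infty)$ and a measurable log-concave function $g^\varepsilon:\mathbb{R}^d\to[0,+\infty)$ such that \[ \pi^\varepsilon(dx\,dy)=f^\varepsilon(x)\,g^\varepsilon(y)\,R^\varepsilon(dx\,dy). \] Moreover $\log f^\varepsilon$ is $\mu$-integrable, $g^\varepsilon>0$ $\nu$-almost everywhere, $\log g^\varepsilon$ is $\nu$-integrable, and \[ \mathcal{T}_H^\varepsilon(\mu,\nu)=H(\pi^\varepsilon|R^\varepsilon)=\int\log f^\varepsilon\,d\mu+\int\log g^\varepsilon\,d\nu<+\infty . \] -/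

import Mathlib

open MeasureTheory ProbabilityTheory InformationTheory
open scoped ENNReal

/-- A convex function with values in `ℝ ∪ {+∞}`: it never takes the value `-∞` and satisfies the
convexity inequality (where `t * ⊤ = ⊤` for `t > 0`). -/
def IsConvexExtended {E : Type*} [AddCommGroup E] [Module ℝ E] (V : E → EReal) : Prop :=
  (∀ x, V x ≠ ⊥) ∧
    ∀ x y : E, ∀ a b : ℝ, 0 < a → 0 < b → a + b = 1 →
      V (a • x + b • y) ≤ (a : EReal) * V x + (b : EReal) * V y

/-- A positive function whose logarithm is convex. -/
def IsLogConvex {E : Type*} [AddCommGroup E] [Module ℝ E] (f : E → ℝ) : Prop :=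
  (∀ x, 0 < f x) ∧ ConvexOn ℝ Set.univ (fun x => Real.log (f x))

/-- A nonnegative function whose logarithm, with the convention `log 0 = -∞`, is concave;
the defining inequality is written multiplicatively so that zeros are allowed. -/
def IsLogConcave {E : Type*} [AddCommGroup E] [Module ℝ E] (g : E → ℝ) : Prop :=
  (∀ x, 0 ≤ g x) ∧
    ∀ x y : E, ∀ a b : ℝ, 0 < a → 0 < b → a + b = 1 →
      g x ^ a * g y ^ b ≤ g (a • x + b • y)

/-- The joint law at times `0` and `ε` of the stationary Ornstein-Uhlenbeck process: the law of
`(X, e^{-ε/2} X + √(1 - e^{-ε}) Y)` for independent standard Gaussian vectors `X`, `Y`. -/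
noncomputable def ouJointLaw (d : ℕ) (ε : ℝ) :
    Measure (EuclideanSpace ℝ (Fin d) × EuclideanSpace ℝ (Fin d)) :=
  ((stdGaussian (EuclideanSpace ℝ (Fin d))).prod (stdGaussian (EuclideanSpace ℝ (Fin d)))).map
    (fun p => (p.1, Real.exp (-ε / 2) • p.1 + Real.sqrt (1 - Real.exp (-ε)) • p.2))

/-- `π` is a coupling of `μ` and `ν`: its marginals are `μ` and `ν`. -/
def IsCouplingOf {X Y : Type*} [MeasurableSpace X] [MeasurableSpace Y]
    (μ : Measure X) (ν : Measure Y) (π : Measure (X × Y)) : Prop :=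
  π.map Prod.fst = μ ∧ π.map Prod.snd = ν

/-- The entropic transport cost: the infimum over the couplings of `μ` and `ν` of the relative
entropy with respect to `ouJointLaw d ε`. -/
noncomputable def entropicCost {d : ℕ} (ε : ℝ) (μ ν : Measure (EuclideanSpace ℝ (Fin d))) :
    ℝ≥0∞ :=
  ⨅ (π : Measure (EuclideanSpace ℝ (Fin d) × EuclideanSpace ℝ (Fin d)))
    (_ : IsCouplingOf μ ν π), klDiv π (ouJointLaw d ε)

/-- `π` is an optimal coupling for the entropic transport cost. -/
def IsOptimalEntropicCoupling {d : ℕ} (ε : ℝ) (μ ν : Measure (EuclideanSpace ℝ (Fin d)))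
    (π : Measure (EuclideanSpace ℝ (Fin d) × EuclideanSpace ℝ (Fin d))) : Prop :=
  IsCouplingOf μ ν π ∧ klDiv π (ouJointLaw d ε) = entropicCost ε μ ν

/-! Write `P` for the Ornstein-Uhlenbeck semigroup at time `ε`, `γ` for the Gaussian measure, `e`
for the density of `μ` and `u` for that of `ν`. A measure `f(x) g(y) R(dx dy)` couples `μ` and `ν`
exactly when the Schrödinger system `f · P g = e`, `g · P f = u` holds `γ`-almost everywhere.
Eliminating `g = u / P f` leaves a fixed point problem for `f`, solved by Fortet's iteration `f ↦
max(1, e / P(u / P f))` started at `1`.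

The shape of the potentials is preserved along the iteration: `P` preserves log-convexity by Hölder
and log-concavity by Prékopa-Leindler, so `u / P f` is log-concave, `e / P(u / P f)` is log-convex,
and so is its maximum with `1`. The sequence is increasing, and self-adjointness of `P` gives `∫ f
P(u / P f) dγ = ∫ u dγ = 1` for each iterate.

Convergence rests on an alternative (`SchrodingerData.exists_solution`). Let `c > 0` bound `e` from
below and `M` bound `u` from above. If some iterate has `P f ≥ M / c` almost everywhere on `{u ≠
0}`, the floor `1` is inactive at the next step and equality of masses makes that iterate a
solution. Otherwise compactness yields one point `y` with `P f ≤ M / c` at `y` for every iterate;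
the limit is then finite, by log-convexity everywhere, and comparison of masses shows that it is a
solution.

Finiteness of `P f` at one point gives `log f` at most quadratic growth, hence `μ`-integrability;
`log g` is then `ν`-integrable because the negative part of `log (f g)` is always integrable under
the coupling. As `log f(x) + log g(y)` has the same integral under all couplings, a Pythagorean
identity for the entropy yields optimality, uniqueness and the value (`optimal_of_product_density`).
-/

/-! ### The Prékopa-Leindler inequality on the line. -/

/-- The Prékopa-Leindler inequality for a measure on a real vector space. -/
def IsPrekopaLeindler {F : Type*} [AddCommGroup F] [Module ℝ F] [MeasurableSpace F]
    (μ : Measure F) : Prop :=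
  ∀ s t : ℝ, 0 < s → 0 < t → s + t = 1 → ∀ f g h : F → ℝ≥0∞,
    Measurable f → Measurable g → Measurable h →
    (∀ x y, f x ^ s * g y ^ t ≤ h (s • x + t • y)) →
    (∫⁻ x, f x ∂μ) ^ s * (∫⁻ x, g x ∂μ) ^ t ≤ ∫⁻ x, h x ∂μ

theorem ENNReal.geom_mean_le_arith_mean2_weighted {s t : ℝ} (hs : 0 < s) (ht : 0 < t)
    (hst : s + t = 1) (p q : ℝ≥0∞) :
    p ^ s * q ^ t ≤ ENNReal.ofReal s * p + ENNReal.ofReal t * q := by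
  by_cases hp : p = ∞
  · have : ENNReal.ofReal s * p = ∞ := by
      rw [hp]; exact ENNReal.mul_top (by simpa using hs)
    simp [this]
  by_cases hq : q = ∞
  · have : ENNReal.ofReal t * q = ∞ := by
      rw [hq]; exact ENNReal.mul_top (by simpa using ht)
    simp [this]
  lift p to NNReal using hp
  lift q to NNReal using hq
  have h := NNReal.geom_mean_le_arith_mean2_weighted s.toNNReal t.toNNReal p q
    (by rw [← Real.toNNReal_add hs.le ht.le, hst]; simp)
  rw [Real.coe_toNNReal s hs.le, Real.coe_toNNReal t ht.le] at h
  rw [← ENNReal.coe_rpow_of_nonneg _ hs.le, ← ENNReal.coe_rpow_of_nonneg _ ht.le]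
  unfold ENNReal.ofReal
  exact_mod_cast h

/-- The Brunn-Minkowski inequality on the real line. -/
theorem Real.volume_add_volume_le {A B C : Set ℝ} (hA : MeasurableSet A) (hB : MeasurableSet B)
    (hA0 : A.Nonempty) (hB0 : B.Nonempty) (h : ∀ a ∈ A, ∀ b ∈ B, a + b ∈ C) :
    volume A + volume B ≤ volume C := by
  have key : ∀ K L : Set ℝ, K ⊆ A → IsCompact K → L ⊆ B → IsCompact L →
      volume K + volume L ≤ volume C := by
    intro K L hKA hK hLB hL
    have left : ∀ b ∈ B, volume K ≤ volume C := fun b hb => by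
      rw [← measure_preimage_add_right volume (-b) K]
      refine measure_mono fun x hx => ?_
      have := h _ (hKA hx) b hb
      simpa using this
    have right : ∀ a ∈ A, volume L ≤ volume C := fun a ha => by
      rw [← measure_preimage_add volume (-a) L]
      refine measure_mono fun x hx => ?_
      have := h a ha _ (hLB hx)
      simpa using this
    rcases K.eq_empty_or_nonempty with rfl | hK0
    · simpa using right _ hA0.some_mem
    rcases L.eq_empty_or_nonempty with rfl | hL0
    · simpa using left _ hB0.some_mem
    have hM := hK.sSup_mem hK0
    have hm := hL.sInf_mem hL0
    set M := sSup K
    set m := sInf L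
    -- The translates `K + m` and `M + L` both lie in `C` and meet at most in the point `M + m`,
    -- since the first lies to its left and the second to its right.
    rw [← measure_preimage_add_right volume (-m) K, ← measure_preimage_add volume (-M) L,
      ← measure_union₀]
    · refine measure_mono ?_
      rintro x (hx | hx)
      · have := h _ (hKA hx) _ (hLB hm)
        simpa using this
      · have := h _ (hKA hM) _ (hLB hx)
        simpa using this
    · exact ((measurable_const_add (-M)) hL.measurableSet).nullMeasurableSet
    · refine measure_mono_null (t := {M + m}) ?_ (by simp)
      rintro x ⟨hx, hx'⟩
      have h1 : x + -m ≤ M := le_csSup hK.bddAbove hx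
      have h2 : m ≤ -M + x := csInf_le hL.bddBelow hx'
      simp only [Set.mem_singleton_iff]
      linarith
  rw [hA.measure_eq_iSup_isCompact, hB.measure_eq_iSup_isCompact]
  simp only [iSup_and', iSup_subtype']
  have : Nonempty {K : Set ℝ // K ⊆ A ∧ IsCompact K} := ⟨⟨∅, by simp⟩⟩
  have : Nonempty {K : Set ℝ // K ⊆ B ∧ IsCompact K} := ⟨⟨∅, by simp⟩⟩
  exact ENNReal.iSup_add_iSup_le fun K L => key K L K.2.1 K.2.2 L.2.1 L.2.2

/-- Layer-cake form of Brunn-Minkowski: `s {f > r} + t {g > r}` is contained in `{h > r}`. Having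
supremum exactly `1` makes both superlevel sets nonempty for `r < 1` and empty for `r ≥ 1`, so the
inequality can be integrated over all levels. -/
theorem Real.lintegral_arith_le_of_prekopaLeindler {s t : ℝ} (hs : 0 < s) (ht : 0 < t)
    (hst : s + t = 1) {f g h : ℝ → ℝ} (hf : Measurable f) (hg : Measurable g) (hh : Measurable h)
    (hf0 : ∀ x, 0 ≤ f x) (hg0 : ∀ x, 0 ≤ g x) (hh0 : ∀ x, 0 ≤ h x)
    (hf1 : ∀ x, f x ≤ 1) (hg1 : ∀ x, g x ≤ 1)
    (hfs : ∀ r < 1, ∃ x, r < f x) (hgs : ∀ r < 1, ∃ x, r < g x)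
    (hfgh : ∀ x y, f x ^ s * g y ^ t ≤ h (s * x + t * y)) :
    ENNReal.ofReal s * (∫⁻ x, ENNReal.ofReal (f x)) + ENNReal.ofReal t * (∫⁻ x, ENNReal.ofReal (g x))
      ≤ ∫⁻ x, ENNReal.ofReal (h x) := by
  have anti : ∀ k : ℝ → ℝ, Measurable fun r : ℝ => volume {a | r < k a} := fun k =>
    Antitone.measurable fun r r' hr => measure_mono fun a ha => lt_of_le_of_lt hr ha
  rw [lintegral_eq_lintegral_meas_lt volume (.of_forall hf0) hf.aemeasurable,
    lintegral_eq_lintegral_meas_lt volume (.of_forall hg0) hg.aemeasurable,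
    lintegral_eq_lintegral_meas_lt volume (.of_forall hh0) hh.aemeasurable,
    ← lintegral_const_mul _ (anti f), ← lintegral_const_mul _ (anti g),
    ← lintegral_add_left ((anti f).const_mul _)]
  refine setLIntegral_mono (anti h) fun r hr => ?_
  have hr : 0 < r := hr
  rcases lt_or_ge r 1 with hr1 | hr1
  · have sc : ∀ (c : ℝ) (_ : 0 < c) (k : ℝ → ℝ), ENNReal.ofReal c * volume {a | r < k a}
        = volume {a | r < k (c⁻¹ * a)} := fun c hc k => by
      have := Real.volume_preimage_mul_left (inv_ne_zero hc.ne') {a | r < k a}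
      rw [inv_inv, abs_of_pos hc] at this
      rw [← this]; rfl
    rw [sc s hs, sc t ht]
    refine Real.volume_add_volume_le ?_ ?_ ?_ ?_ ?_
    · exact measurableSet_lt measurable_const (hf.comp (measurable_const_mul _))
    · exact measurableSet_lt measurable_const (hg.comp (measurable_const_mul _))
    · obtain ⟨x, hx⟩ := hfs r hr1
      exact ⟨s * x, by simpa [hs.ne'] using hx⟩
    · obtain ⟨x, hx⟩ := hgs r hr1
      exact ⟨t * x, by simpa [ht.ne'] using hx⟩
    · intro x hx y hy
      have h1 := hfgh (s⁻¹ * x) (t⁻¹ * y)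
      rw [mul_inv_cancel_left₀ hs.ne', mul_inv_cancel_left₀ ht.ne'] at h1
      refine lt_of_lt_of_le ?_ h1
      have h2 : r ^ s < f (s⁻¹ * x) ^ s := Real.rpow_lt_rpow hr.le hx hs
      have h3 : r ^ t < g (t⁻¹ * y) ^ t := Real.rpow_lt_rpow hr.le hy ht
      calc r = r ^ s * r ^ t := by rw [← Real.rpow_add hr, hst, Real.rpow_one]
        _ < _ := mul_lt_mul'' h2 h3 (Real.rpow_nonneg hr.le _) (Real.rpow_nonneg hr.le _)
  · have e1 : {a | r < f a} = ∅ := Set.eq_empty_of_forall_notMem fun a ha =>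
      absurd ((hf1 a).trans hr1) (not_le.2 ha)
    have e2 : {a | r < g a} = ∅ := Set.eq_empty_of_forall_notMem fun a ha =>
      absurd ((hg1 a).trans hr1) (not_le.2 ha)
    simp [e1, e2]

/-- Dividing `f` and `g` by their suprema and `h` by `κ` reduces to the arithmetic form, from which
weighted AM-GM recovers the geometric one. Truncating `h / κ` at `1` costs nothing, as the
normalised left side is at most `1`, and makes it real-valued. -/
theorem isPrekopaLeindler_real_of_bounded {s t : ℝ} (hs : 0 < s) (ht : 0 < t) (hst : s + t = 1)
    {f g h : ℝ → ℝ≥0∞} (hf : Measurable f) (hg : Measurable g) (hh : Measurable h)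
    (hfb : ⨆ x, f x ≠ ∞) (hgb : ⨆ x, g x ≠ ∞)
    (hfgh : ∀ x y, f x ^ s * g y ^ t ≤ h (s * x + t * y)) :
    (∫⁻ x, f x) ^ s * (∫⁻ x, g x) ^ t ≤ ∫⁻ x, h x := by
  set α := ⨆ x, f x with hα
  set β := ⨆ x, g x with hβ
  have hfα : ∀ x, f x ≤ α := le_iSup f
  have hgβ : ∀ x, g x ≤ β := le_iSup g
  by_cases hα0 : α = 0
  · have : ∀ x, f x = 0 := fun x => le_antisymm (hα0 ▸ hfα x) bot_le
    simp [this, hs]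
  by_cases hβ0 : β = 0
  · have : ∀ x, g x = 0 := fun x => le_antisymm (hβ0 ▸ hgβ x) bot_le
    simp [this, ht]
  set κ := α ^ s * β ^ t with hκ
  have hκ0 : κ ≠ 0 := mul_ne_zero (by simp [hα0, hfb]) (by simp [hβ0, hgb])
  have hκt : κ ≠ ∞ := ENNReal.mul_ne_top (ENNReal.rpow_ne_top_of_nonneg hs.le hfb)
    (ENNReal.rpow_ne_top_of_nonneg ht.le hgb)
  have nf : ∀ x, f x / α ≠ ∞ := fun x =>
    ENNReal.div_ne_top (ne_top_of_le_ne_top hfb (hfα x)) hα0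
  have ng : ∀ x, g x / β ≠ ∞ := fun x =>
    ENNReal.div_ne_top (ne_top_of_le_ne_top hgb (hgβ x)) hβ0
  have f1 : ∀ x, f x / α ≤ 1 := fun x => ENNReal.div_le_of_le_mul (by simpa using hfα x)
  have g1 : ∀ x, g x / β ≤ 1 := fun x => ENNReal.div_le_of_le_mul (by simpa using hgβ x)
  have nh : ∀ x, min (h x / κ) 1 ≠ ∞ := fun x => ne_top_of_le_ne_top ENNReal.one_ne_top
    (min_le_right _ _)
  have sup1 : ∀ (k : ℝ → ℝ≥0∞) (c : ℝ≥0∞), c = ⨆ x, k x → c ≠ 0 → c ≠ ∞ →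
      (∀ x, k x / c ≠ ∞) → ∀ r < 1, ∃ x, r < (k x / c).toReal := by
    intro k c hc hc0 hct hk r hr
    by_contra! hcon
    have : ∀ x, k x ≤ ENNReal.ofReal r * c := fun x => by
      have h2 := ENNReal.ofReal_le_ofReal (hcon x)
      rw [ENNReal.ofReal_toReal (hk x)] at h2
      rwa [ENNReal.div_le_iff hc0 hct] at h2
    have h3 : c ≤ ENNReal.ofReal r * c := by
      conv_lhs => rw [hc]
      exact iSup_le this
    have h4 : ENNReal.ofReal r * c < 1 * c :=
      (ENNReal.mul_lt_mul_iff_left hc0 hct).2 (by simpa using hr)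
    exact absurd h3 (not_le.2 (by simpa using h4))
  have main := Real.lintegral_arith_le_of_prekopaLeindler hs ht hst
    (f := fun x => (f x / α).toReal) (g := fun x => (g x / β).toReal)
    (h := fun x => (min (h x / κ) 1).toReal)
    (hf.div_const _).ennreal_toReal (hg.div_const _).ennreal_toReal
    ((hh.div_const _).min measurable_const).ennreal_toReal
    (fun x => ENNReal.toReal_nonneg) (fun x => ENNReal.toReal_nonneg)
    (fun x => ENNReal.toReal_nonneg)
    (fun x => by simpa using ENNReal.toReal_mono ENNReal.one_ne_top (f1 x))
    (fun x => by simpa using ENNReal.toReal_mono ENNReal.one_ne_top (g1 x))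
    (sup1 f α hα hα0 hfb nf) (sup1 g β hβ hβ0 hgb ng)
    (fun x y => by
      simp only [ENNReal.toReal_rpow, ← ENNReal.toReal_mul]
      refine ENNReal.toReal_mono (nh _) (le_min ?_ ?_)
      · rw [ENNReal.div_rpow_of_nonneg _ _ hs.le, ENNReal.div_rpow_of_nonneg _ _ ht.le,
          ENNReal.le_div_iff_mul_le (.inl hκ0) (.inl hκt)]
        refine le_trans (le_of_eq ?_) (hfgh x y)
        have hα1 : α ^ s ≠ 0 := by simp [hα0, hfb]
        have hβ1 : β ^ t ≠ 0 := by simp [hβ0, hgb]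
        have hα2 : α ^ s ≠ ∞ := ENNReal.rpow_ne_top_of_nonneg hs.le hfb
        have hβ2 : β ^ t ≠ ∞ := ENNReal.rpow_ne_top_of_nonneg ht.le hgb
        rw [hκ, mul_mul_mul_comm, ENNReal.div_mul_cancel hα1 hα2, ENNReal.div_mul_cancel hβ1 hβ2]
      · exact mul_le_one' (ENNReal.rpow_le_one (f1 x) hs.le) (ENNReal.rpow_le_one (g1 y) ht.le))
  simp only [ENNReal.ofReal_toReal (nf _), ENNReal.ofReal_toReal (ng _),
    ENNReal.ofReal_toReal (nh _)] at main
  have m2 := (ENNReal.geom_mean_le_arith_mean2_weighted hs ht hst _ _).trans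
    (main.trans (lintegral_mono fun x => min_le_left _ _))
  simp only [div_eq_mul_inv] at m2
  rw [lintegral_mul_const _ hf, lintegral_mul_const _ hg, lintegral_mul_const _ hh,
    ← div_eq_mul_inv, ← div_eq_mul_inv, ← div_eq_mul_inv,
    ENNReal.le_div_iff_mul_le (.inl hκ0) (.inl hκt), ENNReal.div_rpow_of_nonneg _ _ hs.le,
    ENNReal.div_rpow_of_nonneg _ _ ht.le] at m2
  have hα1 : α ^ s ≠ 0 := by simp [hα0, hfb]
  have hβ1 : β ^ t ≠ 0 := by simp [hβ0, hgb]
  have hα2 : α ^ s ≠ ∞ := ENNReal.rpow_ne_top_of_nonneg hs.le hfb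
  have hβ2 : β ^ t ≠ ∞ := ENNReal.rpow_ne_top_of_nonneg ht.le hgb
  rwa [hκ, mul_mul_mul_comm, ENNReal.div_mul_cancel hα1 hα2, ENNReal.div_mul_cancel hβ1 hβ2] at m2

theorem isPrekopaLeindler_volume_real : IsPrekopaLeindler (volume : Measure ℝ) := by
  intro s t hs ht hst f g h hf hg hh hfgh
  by_cases hf0 : ∫⁻ x, f x = 0
  · simp [hf0, hs]
  by_cases hg0 : ∫⁻ x, g x = 0
  · simp [hg0, ht]
  have lim : ∀ k : ℝ → ℝ≥0∞, Measurable k → Filter.Tendsto (fun n : ℕ => ∫⁻ x, min (k x) n)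
      Filter.atTop (nhds (∫⁻ x, k x)) := by
    intro k hk
    refine lintegral_tendsto_of_tendsto_of_monotone
      (fun n => (hk.min measurable_const).aemeasurable)
      (.of_forall fun x n m hnm => min_le_min_left _ (by exact_mod_cast hnm))
      (.of_forall fun x => ?_)
    have := (tendsto_const_nhds (x := k x) (f := Filter.atTop)).min
      ENNReal.tendsto_nat_nhds_top
    simpa using this
  have l1 := ((ENNReal.continuous_rpow_const (y := s)).tendsto _).comp (lim f hf)
  have l2 := ((ENNReal.continuous_rpow_const (y := t)).tendsto _).comp (lim g hg)
  -- The case of a zero integral was removed beforehand because the product is discontinuous at `0 ·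
  -- ∞`.
  have l3 := ENNReal.Tendsto.mul l1 (.inl (by simp [hf0, hs, hs.not_gt])) l2
    (.inl (by simp [hg0, ht, ht.not_gt]))
  refine le_of_tendsto' l3 fun n => ?_
  refine isPrekopaLeindler_real_of_bounded hs ht hst (hf.min measurable_const)
    (hg.min measurable_const) hh
    (ne_top_of_le_ne_top (ENNReal.natCast_ne_top n) (iSup_le fun x => min_le_right _ _))
    (ne_top_of_le_ne_top (ENNReal.natCast_ne_top n) (iSup_le fun x => min_le_right _ _))
    fun x y => le_trans ?_ (hfgh x y)
  exact mul_le_mul' (ENNReal.rpow_le_rpow (min_le_left _ _) hs.le)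
    (ENNReal.rpow_le_rpow (min_le_left _ _) ht.le)

/-! ### Stability of Prékopa-Leindler, and the Gaussian measure. -/

namespace IsPrekopaLeindler

variable {F G : Type*} [AddCommGroup F] [Module ℝ F] [MeasurableSpace F]
  [AddCommGroup G] [Module ℝ G] [MeasurableSpace G]

theorem withDensity {μ : Measure F} (hμ : IsPrekopaLeindler μ) {w : F → ℝ≥0∞} (hw : Measurable w)
    (hwc : ∀ s t : ℝ, 0 < s → 0 < t → s + t = 1 → ∀ x y,
      w x ^ s * w y ^ t ≤ w (s • x + t • y)) : IsPrekopaLeindler (μ.withDensity w) := by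
  intro s t hs ht hst f g h hf hg hh hfgh
  rw [lintegral_withDensity_eq_lintegral_mul _ hw hf, lintegral_withDensity_eq_lintegral_mul _ hw hg,
    lintegral_withDensity_eq_lintegral_mul _ hw hh]
  refine hμ s t hs ht hst _ _ _ (hw.mul hf) (hw.mul hg) (hw.mul hh) fun x y => ?_
  simp only [Pi.mul_apply]
  rw [ENNReal.mul_rpow_of_nonneg _ _ hs.le, ENNReal.mul_rpow_of_nonneg _ _ ht.le,
    mul_mul_mul_comm]
  exact mul_le_mul' (hwc s t hs ht hst x y) (hfgh x y)

theorem map {μ : Measure F} (hμ : IsPrekopaLeindler μ) (L : F →ₗ[ℝ] G) (hL : Measurable L) :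
    IsPrekopaLeindler (μ.map L) := by
  intro s t hs ht hst f g h hf hg hh hfgh
  rw [lintegral_map hf hL, lintegral_map hg hL, lintegral_map hh hL]
  refine hμ s t hs ht hst _ _ _ (hf.comp hL) (hg.comp hL) (hh.comp hL) fun x y => ?_
  simpa using hfgh (L x) (L y)

/-- Tensorisation: the inequality for `ν` on slices is precisely the hypothesis needed to apply the
inequality for `μ` to the partial integrals. -/
theorem prod {μ : Measure F} {ν : Measure G} [SFinite ν] (hμ : IsPrekopaLeindler μ)
    (hν : IsPrekopaLeindler ν) : IsPrekopaLeindler (μ.prod ν) := by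
  intro s t hs ht hst f g h hf hg hh hfgh
  rw [lintegral_prod _ hf.aemeasurable, lintegral_prod _ hg.aemeasurable,
    lintegral_prod _ hh.aemeasurable]
  refine hμ s t hs ht hst _ _ _ hf.lintegral_prod_right' hg.lintegral_prod_right'
    hh.lintegral_prod_right' fun x x' => ?_
  exact hν s t hs ht hst _ _ _ (hf.comp measurable_prodMk_left) (hg.comp measurable_prodMk_left)
    (hh.comp measurable_prodMk_left) fun y y' => hfgh (x, y) (x', y')

theorem pi {μ : Measure ℝ} [SigmaFinite μ] (hμ : IsPrekopaLeindler μ) (n : ℕ) :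
    IsPrekopaLeindler (Measure.pi fun _ : Fin n => μ) := by
  induction n with
  | zero =>
    intro s t hs ht hst f g h hf hg hh hfgh
    rw [Measure.pi_of_empty, lintegral_dirac' _ hf, lintegral_dirac' _ hg, lintegral_dirac' _ hh]
    refine (hfgh _ _).trans (le_of_eq ?_)
    congr 1
    exact Subsingleton.elim _ _
  | succ n ih =>
    have hp := (measurePreserving_piFinSuccAbove (fun _ : Fin (n + 1) => μ) 0).symm.map_eq
    rw [← hp]
    let L : ℝ × (Fin n → ℝ) →ₗ[ℝ] (Fin (n + 1) → ℝ) :=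
      { toFun := (MeasurableEquiv.piFinSuccAbove (fun _ : Fin (n + 1) => ℝ) 0).symm
        map_add' := fun x y => by
          ext i
          refine Fin.cases ?_ (fun j => ?_) i <;>
            simp [MeasurableEquiv.piFinSuccAbove, Fin.insertNthEquiv]
        map_smul' := fun c x => by
          ext i
          refine Fin.cases ?_ (fun j => ?_) i <;>
            simp [MeasurableEquiv.piFinSuccAbove, Fin.insertNthEquiv] }
    exact (hμ.prod ih).map L (MeasurableEquiv.measurable _)

end IsPrekopaLeindler

theorem isPrekopaLeindler_gaussianReal : IsPrekopaLeindler (gaussianReal 0 1) := by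
  rw [gaussianReal_of_var_ne_zero 0 one_ne_zero]
  refine isPrekopaLeindler_volume_real.withDensity (measurable_gaussianPDF 0 1) ?_
  intro s t hs ht hst x y
  have p : ∀ z : ℝ, 0 < gaussianPDFReal 0 1 z := fun z => gaussianPDFReal_pos 0 1 z one_ne_zero
  simp only [gaussianPDF]
  rw [ENNReal.ofReal_rpow_of_pos (p x), ENNReal.ofReal_rpow_of_pos (p y),
    ← ENNReal.ofReal_mul (Real.rpow_nonneg (p x).le _)]
  refine ENNReal.ofReal_le_ofReal ?_
  have hc : (0 : ℝ) < (Real.sqrt (2 * Real.pi * 1))⁻¹ := by positivity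
  simp only [gaussianPDFReal, NNReal.coe_one, sub_zero, smul_eq_mul]
  rw [Real.mul_rpow hc.le (Real.exp_pos _).le, Real.mul_rpow hc.le (Real.exp_pos _).le,
    mul_mul_mul_comm, ← Real.rpow_add hc, hst, Real.rpow_one, ← Real.exp_mul, ← Real.exp_mul,
    ← Real.exp_add]
  gcongr
  have : s = 1 - t := by linarith
  subst this
  nlinarith [mul_nonneg (mul_nonneg hs.le ht.le) (sq_nonneg (x - y))]

theorem isPrekopaLeindler_stdGaussian (d : ℕ) :
    IsPrekopaLeindler (stdGaussian (EuclideanSpace ℝ (Fin d))) := by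
  rw [← map_pi_eq_stdGaussian]
  exact (isPrekopaLeindler_gaussianReal.pi d).map
    (WithLp.linearEquiv 2 ℝ (Fin d → ℝ)).symm.toLinearMap (by fun_prop)

/-! ### Gaussian density and null sets. -/

theorem pi_gaussianReal_eq_withDensity (n : ℕ) :
    (Measure.pi fun _ : Fin n => gaussianReal 0 1) =
      (volume : Measure (Fin n → ℝ)).withDensity fun x => ∏ i, gaussianPDF 0 1 (x i) := by
  induction n with
  | zero => rw [volume_pi, Measure.pi_of_empty, Measure.pi_of_empty]; simp
  | succ n ih =>
    have e := (measurePreserving_piFinSuccAbove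
      (fun _ : Fin (n + 1) => gaussianReal 0 1) 0).symm.map_eq
    have e' := (measurePreserving_piFinSuccAbove
      (fun _ : Fin (n + 1) => (volume : Measure ℝ)) 0).symm.map_eq
    have m : ∀ n : ℕ, Measurable fun x : Fin n → ℝ => ∏ i, gaussianPDF 0 1 (x i) := fun n =>
      Finset.measurable_prod _ fun i _ => (measurable_gaussianPDF 0 1).comp (measurable_pi_apply i)
    rw [← e, volume_pi, ← e', ih, gaussianReal_of_var_ne_zero 0 one_ne_zero,
      prod_withDensity (measurable_gaussianPDF 0 1) (m n)]
    ext s hs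
    rw [Measure.map_apply (MeasurableEquiv.measurable _) hs,
      withDensity_apply _ (MeasurableEquiv.measurable _ hs), withDensity_apply _ hs,
      setLIntegral_map hs (m _) (MeasurableEquiv.measurable _), volume_pi]
    refine lintegral_congr fun x => ?_
    rw [Fin.prod_univ_succ]
    simp [MeasurableEquiv.piFinSuccAbove, Fin.insertNthEquiv]

/-- The density of the standard Gaussian measure of Euclidean space. -/
noncomputable def stdGaussianDensity {d : ℕ} (x : EuclideanSpace ℝ (Fin d)) : ℝ :=
  (Real.sqrt (2 * Real.pi))⁻¹ ^ d * Real.exp (-‖x‖ ^ 2 / 2)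

theorem stdGaussian_eq_withDensity (d : ℕ) :
    stdGaussian (EuclideanSpace ℝ (Fin d)) =
      volume.withDensity fun x => ENNReal.ofReal (stdGaussianDensity x) := by
  have hm : Measurable fun x : EuclideanSpace ℝ (Fin d) => ENNReal.ofReal (stdGaussianDensity x) := by
    unfold stdGaussianDensity; fun_prop
  have hv := (EuclideanSpace.volume_preserving_symm_measurableEquiv_toLp (Fin d)).symm
  rw [← map_pi_eq_stdGaussian, pi_gaussianReal_eq_withDensity, ← hv.map_eq]
  ext s hs
  have h1 : MeasurableSet (WithLp.toLp 2 ⁻¹' s : Set (Fin d → ℝ)) :=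
    (WithLp.measurable_toLp 2 (Fin d → ℝ)) hs
  rw [Measure.map_apply (WithLp.measurable_toLp 2 (Fin d → ℝ)) hs, withDensity_apply _ h1,
    withDensity_apply _ hs,
    setLIntegral_map hs hm (MeasurableEquiv.measurable _)]
  refine lintegral_congr fun x => ?_
  simp only [gaussianPDF, stdGaussianDensity]
  rw [← ENNReal.ofReal_prod_of_nonneg fun i _ => gaussianPDFReal_nonneg 0 1 (x i)]
  congr 1
  simp only [gaussianPDFReal, Finset.prod_mul_distrib, ← Real.exp_sum]
  simp [EuclideanSpace.norm_sq_eq, Finset.sum_div, neg_div]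

theorem stdGaussianDensity_pos {d : ℕ} (x : EuclideanSpace ℝ (Fin d)) :
    0 < stdGaussianDensity x := by
  unfold stdGaussianDensity; positivity

theorem measurable_stdGaussianDensity {d : ℕ} :
    Measurable (stdGaussianDensity : EuclideanSpace ℝ (Fin d) → ℝ) := by
  unfold stdGaussianDensity; fun_prop

theorem stdGaussian_null_iff {d : ℕ} {s : Set (EuclideanSpace ℝ (Fin d))} :
    stdGaussian (EuclideanSpace ℝ (Fin d)) s = 0 ↔ volume s = 0 := by
  rw [stdGaussian_eq_withDensity]
  refine ⟨fun h => ?_, fun h => withDensity_absolutelyContinuous _ _ h⟩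
  exact withDensity_absolutelyContinuous' (by have := @measurable_stdGaussianDensity d; fun_prop)
    (.of_forall fun x => by simpa using stdGaussianDensity_pos x) h

/-- Gaussian and Lebesgue null sets coincide, and the latter are invariant under dilations and
translations. Hence the value of the semigroup at a single point controls its argument almost
everywhere. -/
theorem stdGaussian_preimage_affine_null_iff {d : ℕ} {s : Set (EuclideanSpace ℝ (Fin d))}
    (x : EuclideanSpace ℝ (Fin d)) {b : ℝ} (hb : b ≠ 0) :
    stdGaussian (EuclideanSpace ℝ (Fin d)) {z | x + b • z ∈ s} = 0 ↔
      stdGaussian (EuclideanSpace ℝ (Fin d)) s = 0 := by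
  rw [stdGaussian_null_iff, stdGaussian_null_iff]
  have h1 : {z : EuclideanSpace ℝ (Fin d) | x + b • z ∈ s}
      = (fun z => b • z) ⁻¹' ((fun z => x + z) ⁻¹' s) := rfl
  rw [h1, Measure.addHaar_preimage_smul _ hb, measure_preimage_add, mul_eq_zero]
  simp [hb]

/-! ### The Ornstein-Uhlenbeck law and semigroup. -/

theorem exp_ouCoeff_pos {ε : ℝ} (hε : 0 < ε) : 0 < Real.sqrt (1 - Real.exp (-ε)) := by
  refine Real.sqrt_pos.2 ?_
  have : Real.exp (-ε) < 1 := by simpa using hε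
  linarith

/-- Reversibility. With `a = cos θ` and `b = sin θ`, the rotation by `θ` followed by a sign change
of the second coordinate preserves `γ ⊗ γ` and turns the pair `(X, aX + bY)` into `(aX + bY, X)`. -/
theorem map_swap_ouJointLaw (d : ℕ) {ε : ℝ} (hε : 0 < ε) :
    (ouJointLaw d ε).map Prod.swap = ouJointLaw d ε := by
  set γ := stdGaussian (EuclideanSpace ℝ (Fin d)) with hγ
  set a := Real.exp (-ε / 2) with ha
  set b := Real.sqrt (1 - Real.exp (-ε)) with hb
  have ha2 : a ^ 2 = Real.exp (-ε) := by
    rw [ha, ← Real.exp_nat_mul]; congr 1; push_cast; ring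
  have hle : Real.exp (-ε) ≤ 1 := by simpa using hε.le
  have hb2 : b ^ 2 = 1 - a ^ 2 := by rw [ha2, hb, Real.sq_sqrt (by linarith)]
  have hcos : Real.cos (Real.arccos a) = a :=
    Real.cos_arccos (by linarith [Real.exp_pos (-ε / 2)]) (Real.exp_le_one_iff.2 (by linarith))
  have hsin : Real.sin (Real.arccos a) = b := by rw [Real.sin_arccos, hb, ha2]
  have rot := IsGaussian.map_rotation_eq_self (μ := γ) (by simpa using integral_id_stdGaussian)
    (Real.arccos a)
  have neg : γ.map (fun x => -x) = γ :=
    stdGaussian_map (LinearIsometryEquiv.neg ℝ (E := EuclideanSpace ℝ (Fin d)))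
  have flip : (γ.prod γ).map (Prod.map id fun x => -x) = γ.prod γ := by
    rw [← Measure.map_prod_map _ _ measurable_id measurable_neg, neg, Measure.map_id]
  have hT : ouJointLaw d ε = (γ.prod γ).map fun p => (p.1, a • p.1 + b • p.2) := rfl
  rw [hT, Measure.map_map measurable_swap (by fun_prop)]
  conv_rhs => rw [← flip, ← rot]
  rw [Measure.map_map (by fun_prop) (by fun_prop), Measure.map_map (by fun_prop) (by fun_prop)]
  congr 1
  ext1 p
  simp only [Function.comp, ContinuousLinearMap.rotation_apply, hcos, hsin, Prod.map, id,
    Prod.swap_prod_mk]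
  ext1
  · rfl
  · simp only
    have : a • (a • p.1 + b • p.2) + b • -(-b • p.1 + a • p.2) = (a ^ 2 + b ^ 2) • p.1 := by
      module
    rw [this, hb2]
    simp

/-- The Ornstein-Uhlenbeck semigroup at time `ε` acting on `[0, ∞]`-valued functions. -/
noncomputable def ouSemigroup {d : ℕ} (ε : ℝ) (φ : EuclideanSpace ℝ (Fin d) → ℝ≥0∞)
    (x : EuclideanSpace ℝ (Fin d)) : ℝ≥0∞ :=
  ∫⁻ z, φ (Real.exp (-ε / 2) • x + Real.sqrt (1 - Real.exp (-ε)) • z)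
    ∂(stdGaussian (EuclideanSpace ℝ (Fin d)))

section ouSemigroup

variable {d : ℕ} {ε : ℝ} {φ ψ : EuclideanSpace ℝ (Fin d) → ℝ≥0∞}

theorem Measurable.ouSemigroup (hφ : Measurable φ) : Measurable (ouSemigroup ε φ) :=
  Measurable.lintegral_prod_right' (f := fun p : EuclideanSpace ℝ (Fin d) ×
    EuclideanSpace ℝ (Fin d) =>
      φ (Real.exp (-ε / 2) • p.1 + Real.sqrt (1 - Real.exp (-ε)) • p.2)) (by fun_prop)

theorem ouSemigroup_mono (h : φ ≤ ψ) : ouSemigroup ε φ ≤ ouSemigroup ε ψ :=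
  fun _ => lintegral_mono fun _ => h _

theorem ouSemigroup_const (c : ℝ≥0∞) (x : EuclideanSpace ℝ (Fin d)) :
    ouSemigroup ε (fun _ => c) x = c := by
  simp [_root_.ouSemigroup]

theorem ae_comp_ou (hε : 0 < ε) {p : EuclideanSpace ℝ (Fin d) → Prop}
    (h : ∀ᵐ x ∂(stdGaussian (EuclideanSpace ℝ (Fin d))), p x) (x : EuclideanSpace ℝ (Fin d)) :
    ∀ᵐ z ∂(stdGaussian (EuclideanSpace ℝ (Fin d))),
      p (Real.exp (-ε / 2) • x + Real.sqrt (1 - Real.exp (-ε)) • z) :=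
  (stdGaussian_preimage_affine_null_iff (s := {x | ¬ p x}) _ (exp_ouCoeff_pos hε).ne').2 h

theorem ouSemigroup_mono_ae (hε : 0 < ε)
    (h : φ ≤ᵐ[stdGaussian (EuclideanSpace ℝ (Fin d))] ψ) :
    ouSemigroup ε φ ≤ ouSemigroup ε ψ :=
  fun x => lintegral_mono_ae (ae_comp_ou hε h x)

theorem ae_eq_zero_of_ouSemigroup_eq_zero (hε : 0 < ε) (hφ : Measurable φ)
    {x : EuclideanSpace ℝ (Fin d)} (h : ouSemigroup ε φ x = 0) :
    ∀ᵐ y ∂(stdGaussian (EuclideanSpace ℝ (Fin d))), φ y = 0 := by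
  rw [_root_.ouSemigroup, lintegral_eq_zero_iff (by fun_prop)] at h
  exact (stdGaussian_preimage_affine_null_iff (s := {x | ¬ φ x = 0}) _ (exp_ouCoeff_pos hε).ne').1 h

theorem ae_lt_top_of_ouSemigroup_ne_top (hε : 0 < ε) (hφ : Measurable φ)
    {x : EuclideanSpace ℝ (Fin d)} (h : ouSemigroup ε φ x ≠ ∞) :
    ∀ᵐ y ∂(stdGaussian (EuclideanSpace ℝ (Fin d))), φ y < ∞ :=
  (stdGaussian_preimage_affine_null_iff (s := {x | ¬ φ x < ∞}) _ (exp_ouCoeff_pos hε).ne').1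
    (ae_lt_top (by fun_prop) h)

theorem lintegral_ouJointLaw {Φ : EuclideanSpace ℝ (Fin d) × EuclideanSpace ℝ (Fin d) → ℝ≥0∞}
    (hΦ : Measurable Φ) :
    ∫⁻ p, Φ p ∂(ouJointLaw d ε) =
      ∫⁻ x, ∫⁻ z, Φ (x, Real.exp (-ε / 2) • x + Real.sqrt (1 - Real.exp (-ε)) • z)
        ∂(stdGaussian (EuclideanSpace ℝ (Fin d))) ∂(stdGaussian (EuclideanSpace ℝ (Fin d))) := by
  rw [ouJointLaw, lintegral_map hΦ (by fun_prop), lintegral_prod _ (by fun_prop)]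

theorem lintegral_mul_ouJointLaw (hφ : Measurable φ) (hψ : Measurable ψ) :
    ∫⁻ p, φ p.1 * ψ p.2 ∂(ouJointLaw d ε) =
      ∫⁻ x, φ x * ouSemigroup ε ψ x ∂(stdGaussian (EuclideanSpace ℝ (Fin d))) := by
  rw [lintegral_ouJointLaw (by fun_prop)]
  refine lintegral_congr fun x => ?_
  simp only
  rw [lintegral_const_mul _ (by fun_prop), _root_.ouSemigroup]

theorem lintegral_mul_ouJointLaw' (hε : 0 < ε) (hφ : Measurable φ) (hψ : Measurable ψ) :
    ∫⁻ p, φ p.1 * ψ p.2 ∂(ouJointLaw d ε) =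
      ∫⁻ y, ψ y * ouSemigroup ε φ y ∂(stdGaussian (EuclideanSpace ℝ (Fin d))) := by
  rw [← map_swap_ouJointLaw d hε, lintegral_map (by fun_prop) measurable_swap,
    ← lintegral_mul_ouJointLaw hψ hφ]
  simp [mul_comm]

/-- Self-adjointness of the semigroup, a consequence of reversibility; it transfers mass identities
from one marginal to the other. -/
theorem lintegral_mul_ouSemigroup_comm (hε : 0 < ε) (hφ : Measurable φ) (hψ : Measurable ψ) :
    ∫⁻ x, φ x * ouSemigroup ε ψ x ∂(stdGaussian (EuclideanSpace ℝ (Fin d))) =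
      ∫⁻ y, ψ y * ouSemigroup ε φ y ∂(stdGaussian (EuclideanSpace ℝ (Fin d))) := by
  rw [← lintegral_mul_ouJointLaw hφ hψ, lintegral_mul_ouJointLaw' hε hφ hψ]

theorem ouSemigroup_iSup {φ : ℕ → EuclideanSpace ℝ (Fin d) → ℝ≥0∞} (hφ : ∀ n, Measurable (φ n))
    (hmono : Monotone φ) (x : EuclideanSpace ℝ (Fin d)) :
    ouSemigroup ε (fun y => ⨆ n, φ n y) x = ⨆ n, ouSemigroup ε (φ n) x :=
  lintegral_iSup (fun n => (hφ n).comp (by fun_prop)) fun _ _ hnm _ => hmono hnm _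

theorem ouSemigroup_iInf {φ : ℕ → EuclideanSpace ℝ (Fin d) → ℝ≥0∞} (hφ : ∀ n, Measurable (φ n))
    (hanti : Antitone φ) (x : EuclideanSpace ℝ (Fin d)) (hfin : ouSemigroup ε (φ 0) x ≠ ∞) :
    ouSemigroup ε (fun y => ⨅ n, φ n y) x = ⨅ n, ouSemigroup ε (φ n) x :=
  lintegral_iInf (fun n => (hφ n).comp (by fun_prop)) (fun _ _ hnm _ => hanti hnm _) hfin

instance isProbabilityMeasure_ouJointLaw : IsProbabilityMeasure (ouJointLaw d ε) :=
  Measure.isProbabilityMeasure_map (by fun_prop)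

/-- Log-concavity of a `[0, ∞]`-valued function is preserved by the Ornstein-Uhlenbeck semigroup. -/
theorem ouSemigroup_logConcave (hφ : Measurable φ)
    (hc : ∀ x y, ∀ s t : ℝ, 0 < s → 0 < t → s + t = 1 → φ x ^ s * φ y ^ t ≤ φ (s • x + t • y))
    (x y : EuclideanSpace ℝ (Fin d)) (s t : ℝ) (hs : 0 < s) (ht : 0 < t) (hst : s + t = 1) :
    ouSemigroup ε φ x ^ s * ouSemigroup ε φ y ^ t ≤ ouSemigroup ε φ (s • x + t • y) := by
  refine isPrekopaLeindler_stdGaussian d s t hs ht hst _ _ _ (by fun_prop) (by fun_prop)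
    (by fun_prop) fun z w => (hc _ _ s t hs ht hst).trans (le_of_eq ?_)
  congr 1
  module

/-- Log-convexity of a `[0, ∞]`-valued function is preserved by the Ornstein-Uhlenbeck semigroup. -/
theorem ouSemigroup_logConvex (hφ : Measurable φ)
    (hc : ∀ x y, ∀ s t : ℝ, 0 < s → 0 < t → s + t = 1 → φ (s • x + t • y) ≤ φ x ^ s * φ y ^ t)
    (x y : EuclideanSpace ℝ (Fin d)) (s t : ℝ) (hs : 0 < s) (ht : 0 < t) (hst : s + t = 1) :
    ouSemigroup ε φ (s • x + t • y) ≤ ouSemigroup ε φ x ^ s * ouSemigroup ε φ y ^ t := by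
  refine le_trans (lintegral_mono fun z => ?_) (ENNReal.lintegral_mul_norm_pow_le
    (p := s) (q := t) (by fun_prop) (by fun_prop) hs.le ht.le hst)
  refine le_trans (le_of_eq ?_) (hc _ _ s t hs ht hst)
  congr 1
  obtain rfl : s = 1 - t := by linarith
  module

/-- Lower semicontinuity of the Ornstein-Uhlenbeck semigroup on continuous functions. -/
theorem isClosed_ouSemigroup_le (hφ : Continuous φ) (c : ℝ≥0∞) :
    IsClosed {y | ouSemigroup ε φ y ≤ c} := by
  rw [← isSeqClosed_iff_isClosed]
  intro y y₀ hy hlim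
  refine le_trans (lintegral_mono fun z => ?_) ((lintegral_liminf_le (f := fun n z =>
    φ (Real.exp (-ε / 2) • y n + Real.sqrt (1 - Real.exp (-ε)) • z)) fun n => by fun_prop).trans
      (Filter.liminf_le_of_frequently_le' (Filter.Frequently.of_forall (f := Filter.atTop) hy)))
  have : Continuous fun y => φ (Real.exp (-ε / 2) • y + Real.sqrt (1 - Real.exp (-ε)) • z) := by
    fun_prop
  exact ((this.tendsto y₀).comp hlim).liminf_eq.ge

end ouSemigroup

/-! ### Log-convex and log-concave functions with values in `[0, ∞]`. -/

/-- The log-convexity inequality for `[0, ∞]`-valued functions. -/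
def ENNReal.LogConvex {E : Type*} [AddCommGroup E] [Module ℝ E] (φ : E → ℝ≥0∞) : Prop :=
  ∀ x y, ∀ s t : ℝ, 0 < s → 0 < t → s + t = 1 → φ (s • x + t • y) ≤ φ x ^ s * φ y ^ t

/-- The log-concavity inequality for `[0, ∞]`-valued functions. -/
def ENNReal.LogConcave {E : Type*} [AddCommGroup E] [Module ℝ E] (φ : E → ℝ≥0∞) : Prop :=
  ∀ x y, ∀ s t : ℝ, 0 < s → 0 < t → s + t = 1 → φ x ^ s * φ y ^ t ≤ φ (s • x + t • y)

/-- Any `x` is the midpoint of `z` and `2x - z`, and for almost every `z` both of these lie in `s`.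
-/
theorem Convex.eq_univ_of_stdGaussian_compl {d : ℕ} {s : Set (EuclideanSpace ℝ (Fin d))}
    (hs : Convex ℝ s) (h : stdGaussian (EuclideanSpace ℝ (Fin d)) sᶜ = 0) : s = Set.univ := by
  refine Set.eq_univ_of_forall fun x => ?_
  have h1 : ∀ᵐ z ∂(stdGaussian (EuclideanSpace ℝ (Fin d))), z ∈ s := h
  have h2 : ∀ᵐ z ∂(stdGaussian (EuclideanSpace ℝ (Fin d))), (2 : ℝ) • x + (-1 : ℝ) • z ∈ s :=
    (stdGaussian_preimage_affine_null_iff _ (by norm_num)).2 h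
  obtain ⟨z, hz, hz'⟩ := (h1.and h2).exists
  convert hs hz hz' (a := 1 / 2) (b := 1 / 2) (by norm_num) (by norm_num) (by norm_num) using 1
  module

theorem IsOpen.stdGaussian_pos {d : ℕ} {s : Set (EuclideanSpace ℝ (Fin d))} (hs : IsOpen s)
    (h : s.Nonempty) : stdGaussian (EuclideanSpace ℝ (Fin d)) s ≠ 0 := by
  rw [Ne, stdGaussian_null_iff]
  exact (hs.measure_pos volume h).ne'

namespace ENNReal.LogConvex

variable {E : Type*} [AddCommGroup E] [Module ℝ E] {φ : E → ℝ≥0∞}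

theorem convex_lt_top (hφ : ENNReal.LogConvex φ) : Convex ℝ {x | φ x < ∞} := by
  refine convex_iff_forall_pos.2 fun x hx y hy s t hs ht hst => ?_
  exact (hφ x y s t hs ht hst).trans_lt (ENNReal.mul_lt_top
    (ENNReal.rpow_lt_top_of_nonneg hs.le (ne_of_lt hx))
    (ENNReal.rpow_lt_top_of_nonneg ht.le (ne_of_lt hy)))

theorem convexOn_log (hφ : ENNReal.LogConvex φ) (h0 : ∀ x, φ x ≠ 0) (ht : ∀ x, φ x ≠ ∞) :
    ConvexOn ℝ Set.univ fun x => Real.log (φ x).toReal := by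
  refine convexOn_iff_forall_pos.2 ⟨convex_univ, fun x _ y _ s t hs ht' hst => ?_⟩
  have p : ∀ x, 0 < (φ x).toReal := fun x => ENNReal.toReal_pos (h0 x) (ht x)
  have h1 := ENNReal.toReal_mono (ENNReal.mul_ne_top (ENNReal.rpow_ne_top_of_nonneg hs.le (ht x))
    (ENNReal.rpow_ne_top_of_nonneg ht'.le (ht y))) (hφ x y s t hs ht' hst)
  rw [ENNReal.toReal_mul, ← ENNReal.toReal_rpow, ← ENNReal.toReal_rpow] at h1
  have h2 := Real.log_le_log (p _) h1
  rwa [Real.log_mul (Real.rpow_pos_of_pos (p x) s).ne' (Real.rpow_pos_of_pos (p y) t).ne',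
    Real.log_rpow (p x), Real.log_rpow (p y)] at h2

theorem iSup {φ : ℕ → E → ℝ≥0∞} (h : ∀ n, ENNReal.LogConvex (φ n)) :
    ENNReal.LogConvex fun x => ⨆ n, φ n x := fun x y s t hs ht hst =>
  iSup_le fun n => (h n x y s t hs ht hst).trans (mul_le_mul'
    (ENNReal.rpow_le_rpow (le_iSup (fun n => φ n x) n) hs.le)
    (ENNReal.rpow_le_rpow (le_iSup (fun n => φ n y) n) ht.le))

theorem max {ψ : E → ℝ≥0∞} (hφ : ENNReal.LogConvex φ) (hψ : ENNReal.LogConvex ψ) :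
    ENNReal.LogConvex fun x => max (φ x) (ψ x) := fun x y s t hs ht hst =>
  max_le ((hφ x y s t hs ht hst).trans (mul_le_mul'
    (ENNReal.rpow_le_rpow (le_max_left _ _) hs.le) (ENNReal.rpow_le_rpow (le_max_left _ _) ht.le)))
    ((hψ x y s t hs ht hst).trans (mul_le_mul'
    (ENNReal.rpow_le_rpow (le_max_right _ _) hs.le)
      (ENNReal.rpow_le_rpow (le_max_right _ _) ht.le)))

theorem const (c : ℝ≥0∞) : ENNReal.LogConvex fun _ : E => c := fun x y s t hs ht hst => by
  rw [← ENNReal.rpow_add_of_nonneg _ _ hs.le ht.le, hst, ENNReal.rpow_one]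

/-- The quotient of a log-convex by a log-concave function. -/
theorem div {ψ : E → ℝ≥0∞} (hφ : ENNReal.LogConvex φ) (hψ : ENNReal.LogConcave ψ)
    (h0 : ∀ x, ψ x ≠ 0) (ht : ∀ x, ψ x ≠ ∞) : ENNReal.LogConvex fun x => φ x / ψ x := by
  intro x y s t hs ht' hst
  simp only [div_eq_mul_inv]
  rw [ENNReal.mul_rpow_of_nonneg _ _ hs.le, ENNReal.mul_rpow_of_nonneg _ _ ht'.le,
    mul_mul_mul_comm, ENNReal.inv_rpow, ENNReal.inv_rpow, ← ENNReal.mul_inv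
      (.inl (by simp [h0, ht])) (.inl (ENNReal.rpow_ne_top_of_nonneg hs.le (ht x)))]
  exact mul_le_mul' (hφ x y s t hs ht' hst) (ENNReal.inv_le_inv.2 (hψ x y s t hs ht' hst))

end ENNReal.LogConvex

/-- The quotient of a log-concave by a log-convex function. -/
theorem ENNReal.LogConcave.div {E : Type*} [AddCommGroup E] [Module ℝ E] {φ ψ : E → ℝ≥0∞}
    (hφ : ENNReal.LogConcave φ) (hψ : ENNReal.LogConvex ψ) (h0 : ∀ x, ψ x ≠ 0) :
    ENNReal.LogConcave fun x => φ x / ψ x := by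
  intro x y s t hs ht hst
  have n0 : ∀ (x : E) {s : ℝ}, 0 < s → ψ x ^ s ≠ 0 := fun x s hs => by
    simp [h0, hs.not_gt]
  simp only [div_eq_mul_inv]
  rw [ENNReal.mul_rpow_of_nonneg _ _ hs.le, ENNReal.mul_rpow_of_nonneg _ _ ht.le,
    mul_mul_mul_comm, ENNReal.inv_rpow, ENNReal.inv_rpow, ← ENNReal.mul_inv
      (.inl (n0 x hs)) (.inr (n0 y ht))]
  exact mul_le_mul' (hφ x y s t hs ht hst) (ENNReal.inv_le_inv.2 (hψ x y s t hs ht hst))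

namespace ENNReal.LogConvex

variable {d : ℕ} {φ : EuclideanSpace ℝ (Fin d) → ℝ≥0∞}

theorem ne_top_of_ae (hφ : ENNReal.LogConvex φ)
    (h : ∀ᵐ x ∂(stdGaussian (EuclideanSpace ℝ (Fin d))), φ x < ∞) (x) : φ x ≠ ∞ := by
  have := hφ.convex_lt_top.eq_univ_of_stdGaussian_compl h
  exact ne_of_lt (Set.eq_univ_iff_forall.1 this x)

/-- A finite convex function on a finite-dimensional space is continuous. This feeds the Fatou
argument that makes sublevel sets of the semigroup closed. -/
theorem continuous (hφ : ENNReal.LogConvex φ) (h0 : ∀ x, φ x ≠ 0) (ht : ∀ x, φ x ≠ ∞) :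
    Continuous φ := by
  have h1 := (hφ.convexOn_log h0 ht).locallyLipschitz.continuous
  have h2 : φ = fun x => ENNReal.ofReal (Real.exp (Real.log (φ x).toReal)) := by
    ext1 x
    rw [Real.exp_log (ENNReal.toReal_pos (h0 x) (ht x)), ENNReal.ofReal_toReal (ht x)]
  rw [h2]
  exact ENNReal.continuous_ofReal.comp (Real.continuous_exp.comp h1)

end ENNReal.LogConvex

/-! ### Regular versions of the densities of the marginals. -/

namespace IsConvexExtended

section

variable {E : Type*} [AddCommGroup E] [Module ℝ E] {V : E → EReal}

theorem toReal_combo_le (hV : IsConvexExtended V) {x y : E} (hx : V x < ⊤) (hy : V y < ⊤)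
    {a b : ℝ} (ha : 0 < a) (hb : 0 < b) (hab : a + b = 1) :
    V (a • x + b • y) < ⊤ ∧
      (V (a • x + b • y)).toReal ≤ a * (V x).toReal + b * (V y).toReal := by
  have h := hV.2 x y a b ha hb hab
  rw [← EReal.coe_toReal hx.ne (hV.1 x), ← EReal.coe_toReal hy.ne (hV.1 y), ← EReal.coe_mul,
    ← EReal.coe_mul, ← EReal.coe_add] at h
  have ht := h.trans_lt (EReal.coe_lt_top _)
  refine ⟨ht, ?_⟩
  rw [← EReal.coe_le_coe_iff, EReal.coe_toReal ht.ne (hV.1 _)]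
  exact_mod_cast h

theorem convexOn_toReal (hV : IsConvexExtended V) :
    ConvexOn ℝ {x | V x < ⊤} fun x => (V x).toReal := by
  refine convexOn_iff_forall_pos.2 ⟨convex_iff_forall_pos.2 ?_, ?_⟩
  · intro x hx y hy a b ha hb hab
    exact (hV.toReal_combo_le hx hy ha hb hab).1
  · intro x hx y hy a b ha hb hab
    exact (hV.toReal_combo_le hx hy ha hb hab).2

end

variable {d : ℕ} {V W : EuclideanSpace ℝ (Fin d) → EReal}

/-- The density is infinite on `{V = ⊤}`, which is therefore null; a convex set of full measure is
the whole space. -/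
theorem lt_top_of_lintegral_exp_ne_top (hV : IsConvexExtended V)
    (h : ∫⁻ x, EReal.exp (V x) ∂(stdGaussian (EuclideanSpace ℝ (Fin d))) ≠ ∞) (x) : V x < ⊤ := by
  have hc : Convex ℝ {x | V x < ⊤} := hV.convexOn_toReal.1
  have hn : NullMeasurableSet {x | V x < ⊤}ᶜ (stdGaussian (EuclideanSpace ℝ (Fin d))) :=
    ((hc.nullMeasurableSet (μ := volume)).mono_ac fun s => stdGaussian_null_iff.2).compl
  refine Set.eq_univ_iff_forall.1 (hc.eq_univ_of_stdGaussian_compl ?_) x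
  by_contra h0
  refine h (top_le_iff.1 ?_)
  calc ∞ = ∫⁻ x in {x | V x < ⊤}ᶜ, ∞ ∂(stdGaussian (EuclideanSpace ℝ (Fin d))) := by
        rw [setLIntegral_const, ENNReal.top_mul h0]
    _ = ∫⁻ x in {x | V x < ⊤}ᶜ, EReal.exp (V x) ∂(stdGaussian (EuclideanSpace ℝ (Fin d))) := by
        refine lintegral_congr_ae ((ae_restrict_mem₀ hn).mono fun x hx => ?_)
        have : V x = ⊤ := by simpa using hx
        simp [this]
    _ ≤ _ := setLIntegral_le_lintegral _ _

theorem exists_convexOn_of_isProbabilityMeasure (hV : IsConvexExtended V)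
    [IsProbabilityMeasure ((stdGaussian (EuclideanSpace ℝ (Fin d))).withDensity
      fun x => EReal.exp (V x))] :
    ∃ v : EuclideanSpace ℝ (Fin d) → ℝ, ConvexOn ℝ Set.univ v ∧ ∀ x, V x = v x := by
  have h : ∫⁻ x, EReal.exp (V x) ∂(stdGaussian (EuclideanSpace ℝ (Fin d))) ≠ ∞ := by
    have := measure_ne_top ((stdGaussian (EuclideanSpace ℝ (Fin d))).withDensity
      fun x => EReal.exp (V x)) Set.univ
    rwa [withDensity_apply _ .univ, Measure.restrict_univ] at this
  have ht := hV.lt_top_of_lintegral_exp_ne_top h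
  refine ⟨fun x => (V x).toReal, ?_, fun x => (EReal.coe_toReal (ht x).ne (hV.1 x)).symm⟩
  have := hV.convexOn_toReal
  rwa [Set.eq_univ_of_forall (s := {x | V x < ⊤}) ht] at this

/-- A log-concave, measurable version of the density `e^{-W}` of a probability measure with compact
support; it is bounded and vanishes outside of the support. -/
theorem exists_logConcave_density (hW : IsConvexExtended W)
    {ν : Measure (EuclideanSpace ℝ (Fin d))} [IsProbabilityMeasure ν]
    (hν : ν = (stdGaussian (EuclideanSpace ℝ (Fin d))).withDensity fun x => EReal.exp (-W x))
    (hc : IsCompact ν.support) :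
    ∃ u : EuclideanSpace ℝ (Fin d) → ℝ≥0∞, Measurable u ∧ ENNReal.LogConcave u ∧
      (∃ M : ℝ, 0 < M ∧ ∀ y, u y ≤ ENNReal.ofReal M) ∧ (∀ y ∉ ν.support, u y = 0) ∧
      ν = (stdGaussian (EuclideanSpace ℝ (Fin d))).withDensity u := by
  classical
  set D := {x | W x < ⊤} with hD
  set w := fun x => (W x).toReal with hw
  have cw : ConvexOn ℝ D w := hW.convexOn_toReal
  have wc : ContinuousOn w (interior D) := cw.continuousOn_interior
  have ci : Convex ℝ (interior D) := cw.1.interior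
  -- Only the interior of the domain is kept: the frontier of a convex set is null, and continuity
  -- of `w` on the interior gives measurability of `u`.
  set u : EuclideanSpace ℝ (Fin d) → ℝ≥0∞ :=
    (interior D).piecewise (fun y => ENNReal.ofReal (Real.exp (-w y))) (fun _ => 0) with hu
  have ui : ∀ y ∈ interior D, u y = ENNReal.ofReal (Real.exp (-w y)) := fun y hy =>
    Set.piecewise_eq_of_mem _ _ _ hy
  have uo : ∀ y ∉ interior D, u y = 0 := fun y hy => Set.piecewise_eq_of_notMem _ _ _ hy
  have um : Measurable u := ContinuousOn.measurable_piecewise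
    (ENNReal.continuous_ofReal.comp_continuousOn (Real.continuous_exp.comp_continuousOn wc.neg))
    continuousOn_const isOpen_interior.measurableSet
  have ae : (fun x => EReal.exp (-W x)) =ᵐ[stdGaussian (EuclideanSpace ℝ (Fin d))] u := by
    have h0 : ∀ᵐ x ∂(stdGaussian (EuclideanSpace ℝ (Fin d))), x ∉ frontier D :=
      by
      rw [ae_iff, stdGaussian_null_iff]
      simpa using cw.1.addHaar_frontier volume
    filter_upwards [h0] with x hx
    by_cases hxi : x ∈ interior D
    · have hxD : x ∈ D := interior_subset hxi
      replace hxD : W x < ⊤ := hxD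
      rw [ui x hxi, ← EReal.coe_toReal hxD.ne (hW.1 x), ← EReal.coe_neg, EReal.exp_coe]
    · have hxD : x ∉ D := fun h => hx ⟨subset_closure h, hxi⟩
      have : W x = ⊤ := by simpa [hD] using hxD
      simp [uo x hxi, this]
  have hνu : ν = (stdGaussian (EuclideanSpace ℝ (Fin d))).withDensity u := by
    rw [hν, withDensity_congr_ae ae]
  have us : ∀ y ∉ ν.support, u y = 0 := by
    intro y hy
    by_contra h
    have hyi : y ∈ interior D := by by_contra h'; exact h (uo y h')
    have hO : IsOpen (interior D ∩ ν.supportᶜ) :=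
      isOpen_interior.inter Measure.isOpen_compl_support
    have h0 : ν (interior D ∩ ν.supportᶜ) = 0 :=
      measure_mono_null Set.inter_subset_right Measure.measure_compl_support
    rw [hνu, withDensity_apply_eq_zero um] at h0
    refine hO.stdGaussian_pos ⟨y, hyi, hy⟩ (measure_mono_null (fun x hx => ?_) h0)
    refine ⟨?_, by rw [← hνu]; exact hx⟩
    simp only [Set.mem_ofPred_eq, ui x hx.1, ne_eq, ENNReal.ofReal_eq_zero, not_le]
    positivity
  refine ⟨u, um, ?_, ?_, us, hνu⟩
  · intro x y s t hs ht hst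
    by_cases hx : x ∈ interior D
    swap
    · simp [uo x hx, hs]
    by_cases hy : y ∈ interior D
    swap
    · simp [uo y hy, ht]
    have hxy : s • x + t • y ∈ interior D := ci hx hy hs.le ht.le hst
    rw [ui _ hx, ui _ hy, ui _ hxy, ENNReal.ofReal_rpow_of_pos (Real.exp_pos _),
      ENNReal.ofReal_rpow_of_pos (Real.exp_pos _), ← ENNReal.ofReal_mul (by positivity),
      ← Real.exp_mul, ← Real.exp_mul, ← Real.exp_add]
    refine ENNReal.ofReal_le_ofReal (Real.exp_le_exp.2 ?_)
    have := cw.2 (interior_subset hx) (interior_subset hy) hs.le ht.le hst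
    simp only [smul_eq_mul] at this
    linarith
  · by_cases hne : (interior D).Nonempty
    swap
    · exact ⟨1, one_pos, fun y => by simp [uo y fun h => hne ⟨y, h⟩]⟩
    obtain ⟨x₀, hx₀⟩ := hne
    have hcont : ∀ᶠ z in nhds x₀, w z < w x₀ + 1 :=
      (wc.continuousAt (isOpen_interior.mem_nhds hx₀)).eventually (gt_mem_nhds (by linarith))
    obtain ⟨r, hr, hball⟩ := Metric.eventually_nhds_iff_ball.1
      (hcont.and (isOpen_interior.mem_nhds hx₀))
    obtain ⟨R, hR⟩ := hc.isBounded.subset_closedBall x₀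
    set B := max R 1 with hB
    have hBp : 0 < B := lt_of_lt_of_le one_pos (le_max_right _ _)
    -- For `y` in the support, the point `z = x₀ + δ (x₀ - y)` stays in the ball where `w < w x₀ +
    -- 1`. Since `x₀` lies between `z` and `y`, convexity bounds `w y` below uniformly in `y`.
    set δ := r / (2 * B) with hδ
    have hδp : 0 < δ := by positivity
    refine ⟨Real.exp (-((1 + δ) * w x₀ - (w x₀ + 1)) / δ), Real.exp_pos _, fun y => ?_⟩
    by_cases hy : y ∈ interior D
    swap
    · simp [uo y hy]
    have hys : y ∈ ν.support := by
      by_contra h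
      have := us y h
      rw [ui y hy, ENNReal.ofReal_eq_zero] at this
      exact absurd this (not_le.2 (Real.exp_pos _))
    rw [ui y hy]
    refine ENNReal.ofReal_le_ofReal (Real.exp_le_exp.2 ?_)
    have hd : ‖x₀ - y‖ ≤ B := by
      have := hR hys
      rw [Metric.mem_closedBall, dist_comm, dist_eq_norm] at this
      exact this.trans (le_max_left _ _)
    set z := x₀ + δ • (x₀ - y) with hz
    have hzb : z ∈ Metric.ball x₀ r := by
      rw [Metric.mem_ball, dist_eq_norm, hz, add_sub_cancel_left, norm_smul, Real.norm_eq_abs,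
        abs_of_pos hδp]
      calc δ * ‖x₀ - y‖ ≤ δ * B := by gcongr
        _ = r / 2 := by rw [hδ]; field_simp
        _ < r := by linarith
    obtain ⟨hz1, hz2⟩ := hball z hzb
    have h1δ : 0 < 1 + δ := by linarith
    have h := cw.2 (interior_subset hz2) (interior_subset hy) 
      (show 0 ≤ 1 / (1 + δ) by positivity) (show 0 ≤ δ / (1 + δ) by positivity) (by field_simp)
    have hx : (1 / (1 + δ)) • z + (δ / (1 + δ)) • y = x₀ := by
      have : (1 / (1 + δ)) • z + (δ / (1 + δ)) • y = ((1 / (1 + δ)) * (1 + δ)) • x₀ := by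
        rw [hz]
        module
      rw [this, one_div_mul_cancel h1δ.ne', one_smul]
    rw [hx] at h
    simp only [smul_eq_mul] at h
    have h2 : (1 + δ) * w x₀ ≤ w z + δ * w y := by
      have := mul_le_mul_of_nonneg_left h h1δ.le
      have e : (1 + δ) * (1 / (1 + δ) * w z + δ / (1 + δ) * w y) = w z + δ * w y := by
        field_simp
      rwa [e] at this
    rw [le_div_iff₀ hδp]
    linarith

end IsConvexExtended

/-! ### Fortet's iteration and the Schrödinger system. -/

section Fortet

variable {d : ℕ} {ε : ℝ} {e u f f' : EuclideanSpace ℝ (Fin d) → ℝ≥0∞}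

/-- The second Schrödinger potential associated with the first one. -/
noncomputable def schrodingerDual (ε : ℝ) (u f : EuclideanSpace ℝ (Fin d) → ℝ≥0∞) :
    EuclideanSpace ℝ (Fin d) → ℝ≥0∞ :=
  fun y => u y / ouSemigroup ε f y

/-- One step of Fortet's iteration for the Schrödinger system. -/
noncomputable def fortetStep (ε : ℝ) (e u f : EuclideanSpace ℝ (Fin d) → ℝ≥0∞) :
    EuclideanSpace ℝ (Fin d) → ℝ≥0∞ :=
  fun x => max 1 (e x / ouSemigroup ε (schrodingerDual ε u f) x)

/-- Fortet's iteration for the Schrödinger system. -/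
noncomputable def fortetSeq (ε : ℝ) (e u : EuclideanSpace ℝ (Fin d) → ℝ≥0∞) :
    ℕ → EuclideanSpace ℝ (Fin d) → ℝ≥0∞
  | 0 => fun _ => 1
  | n + 1 => fortetStep ε e u (fortetSeq ε e u n)

theorem schrodingerDual_anti (h : f ≤ f') : schrodingerDual ε u f' ≤ schrodingerDual ε u f :=
  fun y => ENNReal.div_le_div_left (ouSemigroup_mono h y) _

theorem fortetStep_mono (h : f ≤ f') : fortetStep ε e u f ≤ fortetStep ε e u f' :=
  fun x => max_le_max le_rfl
    (ENNReal.div_le_div_left (ouSemigroup_mono (schrodingerDual_anti h) x) _)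

theorem one_le_fortetSeq (n : ℕ) (x : EuclideanSpace ℝ (Fin d)) : 1 ≤ fortetSeq ε e u n x := by
  cases n with
  | zero => exact le_rfl
  | succ n => exact le_max_left _ _

/-- The step is monotone, being built from two order-reversing divisions, and the floor `1`
guarantees that the first step goes up. -/
theorem monotone_fortetSeq : Monotone (fortetSeq ε e u) := by
  refine monotone_nat_of_le_succ fun n => ?_
  induction n with
  | zero => exact fun x => one_le_fortetSeq 1 x
  | succ n ih => exact fortetStep_mono ih

theorem Measurable.schrodingerDual (hu : Measurable u) (hf : Measurable f) :
    Measurable (schrodingerDual ε u f) :=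
  hu.div hf.ouSemigroup

theorem one_le_ouSemigroup (hf : ∀ x, 1 ≤ f x) (y : EuclideanSpace ℝ (Fin d)) :
    1 ≤ ouSemigroup ε f y := by
  rw [← ouSemigroup_const (ε := ε) 1 y]
  exact ouSemigroup_mono (φ := fun _ => 1) hf y

theorem schrodingerDual_le (hf : ∀ x, 1 ≤ f x) : schrodingerDual ε u f ≤ u := fun y =>
  ENNReal.div_le_of_le_mul (le_mul_of_one_le_right' (one_le_ouSemigroup hf y))

theorem ouSemigroup_ne_zero_of_one_le (hf : ∀ x, 1 ≤ f x) (y : EuclideanSpace ℝ (Fin d)) :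
    ouSemigroup ε f y ≠ 0 := (one_pos.trans_le (one_le_ouSemigroup hf y)).ne'

theorem logConcave_schrodingerDual (hu : ENNReal.LogConcave u) (hfm : Measurable f)
    (hf : ∀ x, 1 ≤ f x) (hfc : ENNReal.LogConvex f) :
    ENNReal.LogConcave (schrodingerDual ε u f) :=
  hu.div (ouSemigroup_logConvex hfm hfc) (ouSemigroup_ne_zero_of_one_le hf)

theorem schrodingerDual_mul_le (y : EuclideanSpace ℝ (Fin d)) :
    schrodingerDual ε u f y * ouSemigroup ε f y ≤ u y :=
  (mul_comm _ _).trans_le ENNReal.mul_div_le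

/-- The data of a Schrödinger system whose solution is built by Fortet's iteration. -/
structure SchrodingerData (e u : EuclideanSpace ℝ (Fin d) → ℝ≥0∞) : Prop where
  measurable_fst : Measurable e
  logConvex_fst : ENNReal.LogConvex e
  fst_ne_top : ∀ x, e x ≠ ∞
  fst_lower : ∃ c, c ≠ 0 ∧ ∀ x, c ≤ e x
  lintegral_fst : ∫⁻ x, e x ∂(stdGaussian (EuclideanSpace ℝ (Fin d))) = 1
  measurable_snd : Measurable u
  logConcave_snd : ENNReal.LogConcave u
  snd_upper : ∃ M, M ≠ ∞ ∧ ∀ y, u y ≤ M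
  snd_compact : ∃ K, IsCompact K ∧ ∀ y ∉ K, u y = 0
  lintegral_snd : ∫⁻ y, u y ∂(stdGaussian (EuclideanSpace ℝ (Fin d))) = 1

/-- The properties preserved by Fortet's iteration. -/
structure IsFortetIterate (ε : ℝ) (u f : EuclideanSpace ℝ (Fin d) → ℝ≥0∞) : Prop where
  measurable : Measurable f
  one_le : ∀ x, 1 ≤ f x
  logConvex : ENNReal.LogConvex f
  ae_ne_top : ∀ᵐ y ∂(stdGaussian (EuclideanSpace ℝ (Fin d))), u y ≠ 0 → ouSemigroup ε f y ≠ ∞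

namespace SchrodingerData

theorem exists_of_ae (h : SchrodingerData e u) {p : EuclideanSpace ℝ (Fin d) → Prop}
    (hp : ∀ᵐ y ∂(stdGaussian (EuclideanSpace ℝ (Fin d))), u y ≠ 0 → p y) : ∃ y, u y ≠ 0 ∧ p y := by
  by_contra! hcon
  have : ∀ᵐ y ∂(stdGaussian (EuclideanSpace ℝ (Fin d))), u y = 0 := by
    filter_upwards [hp] with y hy
    by_contra h0
    exact hcon y h0 (hy h0)
  have h0 := lintegral_congr_ae this
  rw [h.lintegral_snd] at h0
  simp at h0

theorem ouSemigroup_dual_ne_top (h : SchrodingerData e u) (hf : ∀ x, 1 ≤ f x)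
    (x : EuclideanSpace ℝ (Fin d)) : ouSemigroup ε (schrodingerDual ε u f) x ≠ ∞ := by
  obtain ⟨M, hM, hu⟩ := h.snd_upper
  refine ne_top_of_le_ne_top hM ?_
  rw [← ouSemigroup_const (ε := ε) M x]
  exact ouSemigroup_mono (fun y => (schrodingerDual_le hf y).trans (hu y)) x

/-- If it vanished at one point, the dual potential would vanish almost everywhere; but it is
nonzero wherever `u ≠ 0` and `ouSemigroup ε f` is finite. -/
theorem ouSemigroup_dual_ne_zero (h : SchrodingerData e u) (hε : 0 < ε)
    (hf : IsFortetIterate ε u f) (x : EuclideanSpace ℝ (Fin d)) :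
    ouSemigroup ε (schrodingerDual ε u f) x ≠ 0 := by
  intro h0
  have h1 := ae_eq_zero_of_ouSemigroup_eq_zero hε
    (h.measurable_snd.schrodingerDual hf.measurable) h0
  obtain ⟨y, hy, hy1, hy2⟩ := h.exists_of_ae (p := fun y => schrodingerDual ε u f y = 0 ∧
    ouSemigroup ε f y ≠ ∞) (by filter_upwards [h1, hf.ae_ne_top] with y h1 h2 h3; exact ⟨h1, h2 h3⟩)
  rw [schrodingerDual, ENNReal.div_eq_zero_iff] at hy1
  exact hy1.elim hy hy2

theorem lintegral_mul_dual (h : SchrodingerData e u) (hε : 0 < ε) (hf : IsFortetIterate ε u f) :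
    ∫⁻ x, f x * ouSemigroup ε (schrodingerDual ε u f) x
      ∂(stdGaussian (EuclideanSpace ℝ (Fin d))) = 1 := by
  rw [lintegral_mul_ouSemigroup_comm hε hf.measurable
    (h.measurable_snd.schrodingerDual hf.measurable), ← h.lintegral_snd]
  refine lintegral_congr_ae (hf.ae_ne_top.mono fun y hy => ?_)
  simp only [schrodingerDual]
  by_cases h0 : u y = 0
  · simp [h0]
  · exact ENNReal.div_mul_cancel (ouSemigroup_ne_zero_of_one_le hf.one_le y) (hy h0)

/-- Log-convexity combines Hölder and Prékopa-Leindler. For finiteness, self-adjointness gives `∫ g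
P(e / P g) dγ = ∫ e dγ = 1`, so `P(e / P g)` is finite almost everywhere on `{g ≠ 0}`, and the
maximum with `1` adds at most `1`. -/
theorem isFortetIterate_step (h : SchrodingerData e u) (hε : 0 < ε) (hf : IsFortetIterate ε u f) :
    IsFortetIterate ε u (fortetStep ε e u f) := by
  have gm := h.measurable_snd.schrodingerDual (ε := ε) hf.measurable
  set g := schrodingerDual ε u f with hg
  have Tm : Measurable fun x => e x / ouSemigroup ε g x := h.measurable_fst.div gm.ouSemigroup
  have Pg0 : ∀ x, ouSemigroup ε g x ≠ 0 := h.ouSemigroup_dual_ne_zero hε hf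
  have Pgt : ∀ x, ouSemigroup ε g x ≠ ∞ := h.ouSemigroup_dual_ne_top hf.one_le
  refine ⟨measurable_const.max Tm, fun x => le_max_left _ _, ?_, ?_⟩
  · exact (ENNReal.LogConvex.const 1).max (h.logConvex_fst.div (ouSemigroup_logConcave gm
      (logConcave_schrodingerDual h.logConcave_snd hf.measurable hf.one_le hf.logConvex)) Pg0 Pgt)
  · have h1 : ∫⁻ y, g y * ouSemigroup ε (fun x => e x / ouSemigroup ε g x) y
        ∂(stdGaussian (EuclideanSpace ℝ (Fin d))) ≠ ∞ := by
      rw [← lintegral_mul_ouSemigroup_comm hε Tm gm]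
      simp only [ENNReal.div_mul_cancel (Pg0 _) (Pgt _)]
      rw [h.lintegral_fst]
      exact ENNReal.one_ne_top
    filter_upwards [ae_lt_top (gm.mul Tm.ouSemigroup) h1, hf.ae_ne_top] with y hy hfy huy
    have hg0 : g y ≠ 0 := by
      rw [hg, schrodingerDual, Ne, ENNReal.div_eq_zero_iff]
      exact not_or.2 ⟨huy, hfy huy⟩
    have h2 : ouSemigroup ε (fun x => e x / ouSemigroup ε g x) y ≠ ∞ := fun ht => by
      simp [ht, ENNReal.mul_top hg0] at hy
    refine ne_top_of_le_ne_top (ENNReal.add_ne_top.2 ⟨ENNReal.one_ne_top, h2⟩) ?_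
    rw [← ouSemigroup_const (ε := ε) 1 y]
    unfold ouSemigroup
    rw [← lintegral_add_left (by fun_prop)]
    exact lintegral_mono fun z => max_le_add_of_nonneg zero_le zero_le

theorem isFortetIterate_seq (h : SchrodingerData e u) (hε : 0 < ε) (n : ℕ) :
    IsFortetIterate ε u (fortetSeq ε e u n) := by
  induction n with
  | zero =>
    refine ⟨measurable_const, fun _ => le_rfl, .const 1, .of_forall fun y _ => ?_⟩
    change ouSemigroup ε (fun _ => 1) y ≠ ∞
    simp [ouSemigroup_const]
  | succ n ih => exact h.isFortetIterate_step hε ih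

theorem iterate_ne_top (h : SchrodingerData e u) (hε : 0 < ε) (hf : IsFortetIterate ε u f) (x) :
    f x ≠ ∞ := by
  obtain ⟨y, -, hy⟩ := h.exists_of_ae hf.ae_ne_top
  exact hf.logConvex.ne_top_of_ae (ae_lt_top_of_ouSemigroup_ne_top hε hf.measurable hy) x

/-- If an iterate is large on the support of the second marginal, then it is a solution. -/
theorem mul_dual_eq_of_le (h : SchrodingerData e u) (hε : 0 < ε) (hf : IsFortetIterate ε u f)
    (hle : f ≤ fortetStep ε e u f) {c M : ℝ≥0∞} (hc0 : c ≠ 0) (hc : ∀ x, c ≤ e x)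
    (hM : ∀ y, u y ≤ M)
    (hA : ∀ᵐ y ∂(stdGaussian (EuclideanSpace ℝ (Fin d))), u y ≠ 0 → M / c ≤ ouSemigroup ε f y) :
    ∀ᵐ x ∂(stdGaussian (EuclideanSpace ℝ (Fin d))),
      f x * ouSemigroup ε (schrodingerDual ε u f) x = e x := by
  have hct : c ≠ ∞ := ne_top_of_le_ne_top (h.fst_ne_top 0) (hc 0)
  have Pg0 := h.ouSemigroup_dual_ne_zero hε hf
  have Pgt : ∀ x, ouSemigroup ε (schrodingerDual ε u f) x ≠ ∞ := h.ouSemigroup_dual_ne_top hf.one_le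
  -- The threshold `M / c` is chosen to force `g ≤ c ≤ e`. Then `P g ≤ e`, the floor `1` in the step
  -- is inactive, and `f · P g ≤ e` with both sides of mass one.
  have hgc : schrodingerDual ε u f ≤ᵐ[stdGaussian (EuclideanSpace ℝ (Fin d))] fun _ => c := by
    filter_upwards [hA] with y hy
    by_cases h0 : u y = 0
    · simp [schrodingerDual, h0]
    · refine ENNReal.div_le_of_le_mul ((hM y).trans ?_)
      calc M = c * (M / c) := (ENNReal.mul_div_cancel hc0 hct).symm
        _ ≤ _ := by gcongr; exact hy h0
  have hPg : ∀ x, ouSemigroup ε (schrodingerDual ε u f) x ≤ e x := fun x =>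
    (ouSemigroup_mono_ae hε hgc x).trans ((ouSemigroup_const c x).le.trans (hc x))
  have hfe : ∀ x, f x * ouSemigroup ε (schrodingerDual ε u f) x ≤ e x := fun x => by
    rw [← ENNReal.le_div_iff_mul_le (.inl (Pg0 x)) (.inl (Pgt x))]
    refine (hle x).trans (max_le ?_ le_rfl)
    rw [ENNReal.le_div_iff_mul_le (.inl (Pg0 x)) (.inl (Pgt x)), one_mul]
    exact hPg x
  refine ae_eq_of_ae_le_of_lintegral_le (.of_forall hfe) ?_ h.measurable_fst.aemeasurable ?_
  · rw [h.lintegral_mul_dual hε hf]; exact ENNReal.one_ne_top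
  · rw [h.lintegral_mul_dual hε hf, h.lintegral_fst]

/-- The chain `1 = ∫ e ≤ ∫ f P g = ∫ g P f ≤ ∫ u = 1` turns both pointwise inequalities into almost
everywhere equalities. Where `P f = ∞` one has `g = 0`, hence `u = 0`, which gives the finiteness on
`{u ≠ 0}`. -/
theorem isFortetIterate_of_le (h : SchrodingerData e u) (hε : 0 < ε) (hfm : Measurable f)
    (hf1 : ∀ x, 1 ≤ f x) (hfc : ENNReal.LogConvex f)
    (hle : ∀ x, e x ≤ f x * ouSemigroup ε (schrodingerDual ε u f) x) :
    IsFortetIterate ε u f ∧ ∀ᵐ x ∂(stdGaussian (EuclideanSpace ℝ (Fin d))),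
      f x * ouSemigroup ε (schrodingerDual ε u f) x = e x := by
  have gm := h.measurable_snd.schrodingerDual (ε := ε) hfm
  have h1 : ∫⁻ x, f x * ouSemigroup ε (schrodingerDual ε u f) x
      ∂(stdGaussian (EuclideanSpace ℝ (Fin d))) ≤ 1 := by
    rw [lintegral_mul_ouSemigroup_comm hε hfm gm, ← h.lintegral_snd]
    exact lintegral_mono schrodingerDual_mul_le
  have h2 : ∀ᵐ x ∂(stdGaussian (EuclideanSpace ℝ (Fin d))),
      e x = f x * ouSemigroup ε (schrodingerDual ε u f) x :=
    ae_eq_of_ae_le_of_lintegral_le (.of_forall hle) (by simp [h.lintegral_fst])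
      (hfm.mul gm.ouSemigroup).aemeasurable (by rwa [h.lintegral_fst])
  have h3 : ∀ᵐ y ∂(stdGaussian (EuclideanSpace ℝ (Fin d))),
      schrodingerDual ε u f y * ouSemigroup ε f y = u y := by
    have e1 : ∫⁻ y, schrodingerDual ε u f y * ouSemigroup ε f y
        ∂(stdGaussian (EuclideanSpace ℝ (Fin d))) = 1 := by
      rw [← lintegral_mul_ouSemigroup_comm hε hfm gm, ← h.lintegral_fst]
      exact lintegral_congr_ae (h2.mono fun _ hx => hx.symm)
    exact ae_eq_of_ae_le_of_lintegral_le (.of_forall schrodingerDual_mul_le) (by simp [e1])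
      h.measurable_snd.aemeasurable (by rw [e1, h.lintegral_snd])
  refine ⟨⟨hfm, hf1, hfc, h3.mono fun y hy hu ht => hu ?_⟩, h2.mono fun _ hx => hx.symm⟩
  rw [← hy, schrodingerDual, ht]
  simp

/-- Existence of a solution of the Schrödinger system with a log-convex first potential. -/
theorem exists_solution (h : SchrodingerData e u) (hε : 0 < ε) :
    ∃ f, IsFortetIterate ε u f ∧ ∀ᵐ x ∂(stdGaussian (EuclideanSpace ℝ (Fin d))),
      f x * ouSemigroup ε (schrodingerDual ε u f) x = e x := by
  obtain ⟨c, hc0, hc⟩ := h.fst_lower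
  obtain ⟨M, hMt, hM⟩ := h.snd_upper
  obtain ⟨K, hK, hKu⟩ := h.snd_compact
  set s := fortetSeq ε e u with hs
  have hI : ∀ n, IsFortetIterate ε u (s n) := h.isFortetIterate_seq hε
  have mono : Monotone s := monotone_fortetSeq
  by_cases hA : ∃ n, ∀ᵐ y ∂(stdGaussian (EuclideanSpace ℝ (Fin d))),
      u y ≠ 0 → M / c ≤ ouSemigroup ε (s n) y
  · obtain ⟨n, hn⟩ := hA
    exact ⟨s n, hI n, h.mul_dual_eq_of_le hε (hI n) (mono n.le_succ) hc0 hc hM hn⟩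
  push Not at hA
  have hMc : M / c ≠ ∞ := ENNReal.div_ne_top hMt hc0
  have hne : ∀ n, (K ∩ {y | ouSemigroup ε (s n) y ≤ M / c}).Nonempty := fun n => by
    obtain ⟨y, hy⟩ := (hA n).exists
    exact ⟨y, by by_contra hyK; exact hy.1 (hKu y hyK), hy.2.le⟩
  have hcl : ∀ n, IsClosed (K ∩ {y | ouSemigroup ε (s n) y ≤ M / c}) := fun n =>
    hK.isClosed.inter (isClosed_ouSemigroup_le ((hI n).logConvex.continuous
      (fun x => (one_pos.trans_le ((hI n).one_le x)).ne') (h.iterate_ne_top hε (hI n))) _)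
  -- The sets are nested because the iterates increase, so Cantor's intersection theorem provides
  -- one point that serves for all of them.
  obtain ⟨y, hy⟩ := IsCompact.nonempty_iInter_of_sequence_nonempty_isCompact_isClosed
    (fun n => K ∩ {y | ouSemigroup ε (s n) y ≤ M / c})
    (fun n x hx => ⟨hx.1, (ouSemigroup_mono (mono n.le_succ) x).trans hx.2⟩) hne
    (hK.inter_right (isClosed_ouSemigroup_le ((hI 0).logConvex.continuous
      (fun x => (one_pos.trans_le ((hI 0).one_le x)).ne') (h.iterate_ne_top hε (hI 0))) _)) hcl
  rw [Set.mem_iInter] at hy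
  set F := fun x => ⨆ n, s n x with hF
  have hFm : Measurable F := .iSup fun n => (hI n).measurable
  have hF1 : ∀ x, 1 ≤ F x := fun x => ((hI 0).one_le x).trans (le_iSup (fun n => s n x) 0)
  have hFc : ENNReal.LogConvex F := .iSup fun n => (hI n).logConvex
  have hPF : ∀ y, ouSemigroup ε F y = ⨆ n, ouSemigroup ε (s n) y :=
    ouSemigroup_iSup (fun n => (hI n).measurable) mono
  have hFt : ∀ x, F x ≠ ∞ := by
    refine hFc.ne_top_of_ae (ae_lt_top_of_ouSemigroup_ne_top hε hFm (x := y) ?_)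
    rw [hPF]
    exact ne_top_of_le_ne_top hMc (iSup_le fun n => (hy n).2)
  have hF0 : ∀ x, F x ≠ 0 := fun x => (one_pos.trans_le (hF1 x)).ne'
  refine ⟨F, h.isFortetIterate_of_le hε hFm hF1 hFc fun x => ?_⟩
  have hdual : schrodingerDual ε u F = fun y => ⨅ n, schrodingerDual ε u (s n) y := by
    ext1 y
    simp only [schrodingerDual, hPF, div_eq_mul_inv]
    by_cases h0 : u y = 0
    · simp [h0]
    · rw [ENNReal.inv_iSup, ENNReal.mul_iInf_of_ne h0 (ne_top_of_le_ne_top hMt (hM y))]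
  rw [hdual, ouSemigroup_iInf (fun n => h.measurable_snd.schrodingerDual (hI n).measurable)
    (fun n m hnm => schrodingerDual_anti (mono hnm)) _ (h.ouSemigroup_dual_ne_top (hI 0).one_le x),
    ENNReal.mul_iInf_of_ne (hF0 x) (hFt x)]
  -- The `n`-th inequality follows from `e / P g_n ≤ s (n + 1) ≤ F`, where `g_n` is the dual of `s
  -- n`.
  refine le_iInf fun n => ?_
  rw [← ENNReal.div_le_iff_le_mul (.inr (hFt x)) (.inr (hF0 x))]
  exact (le_max_right _ _).trans (le_iSup (fun n => s n x) (n + 1))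

end SchrodingerData

end Fortet

/-! ### Quadratic growth of the logarithm of the first potential. -/

/-- A log-convex function with finite Gaussian integral grows at most like `C e^{|x|²}`. -/
theorem ENNReal.LogConvex.exists_le_exp_sq {d : ℕ} {F : EuclideanSpace ℝ (Fin d) → ℝ≥0∞}
    (hF : ENNReal.LogConvex F) (hm : Measurable F)
    (hI : ∫⁻ z, F z ∂(stdGaussian (EuclideanSpace ℝ (Fin d))) ≠ ∞) :
    ∃ C : ℝ, 0 < C ∧ ∀ z, F z ≤ ENNReal.ofReal (C * Real.exp (‖z‖ ^ 2)) := by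
  set I := ∫⁻ z, F z ∂(stdGaussian (EuclideanSpace ℝ (Fin d))) with hIdef
  set B := Metric.ball (0 : EuclideanSpace ℝ (Fin d)) 1 with hB
  have hBpos : volume B ≠ 0 := (Metric.measure_ball_pos volume _ one_pos).ne'
  have hBfin : volume B ≠ ∞ := measure_ball_lt_top.ne
  have ρm : Measurable fun z : EuclideanSpace ℝ (Fin d) => ENNReal.ofReal (stdGaussianDensity z) :=
    measurable_stdGaussianDensity.ennreal_ofReal
  have hIρ : ∫⁻ z, ENNReal.ofReal (stdGaussianDensity z) * F z = I := by
    rw [hIdef, stdGaussian_eq_withDensity, lintegral_withDensity_eq_lintegral_mul _ ρm hm]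
    rfl
  set c := Real.sqrt (2 * Real.pi) ^ d with hc
  have hcp : 0 < c := by positivity
  -- This dominates the inverse Gaussian density on the unit ball around `z`, because `|z + h|² / 2
  -- ≤ |z|² + |h|² ≤ |z|² + 1`.
  set κ : EuclideanSpace ℝ (Fin d) → ℝ := fun z => c * Real.exp (‖z‖ ^ 2 + 1) with hκ
  have hκρ : ∀ z h : EuclideanSpace ℝ (Fin d), ‖h‖ < 1 → F (z + h) ≤ ENNReal.ofReal (κ z) *
      (ENNReal.ofReal (stdGaussianDensity (z + h)) * F (z + h)) := fun z h hh => by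
    rw [← mul_assoc, ← ENNReal.ofReal_mul (by positivity)]
    refine le_mul_of_one_le_left' (ENNReal.one_le_ofReal.2 ?_)
    have e1 : κ z * stdGaussianDensity (z + h)
        = Real.exp (‖z‖ ^ 2 + 1 + -‖z + h‖ ^ 2 / 2) := by
      rw [Real.exp_add _ (-‖z + h‖ ^ 2 / 2)]
      simp only [hκ, stdGaussianDensity, hc, inv_pow]
      field_simp
    rw [e1]
    refine Real.one_le_exp ?_
    have h1 := norm_add_le z h
    have h2 := norm_nonneg (z + h)
    have h3 := norm_nonneg h
    nlinarith [sq_nonneg (‖z‖ - ‖h‖), pow_le_pow_left₀ h2 h1 2]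
  -- Midpoint log-convexity and AM-GM give `F z ≤ F (z + h) + F (z - h)`; averaging over the ball
  -- bounds `F z` by the Gaussian integral.
  have key : ∀ z, F z * volume B ≤ 2 * (ENNReal.ofReal (κ z) * I) := fun z => by
    have hp : ∫⁻ h in B, F (z + h) ≤ ENNReal.ofReal (κ z) * I := by
      rw [← hIρ, ← lintegral_add_left_eq_self (μ := volume) (fun z => _ * F z) z,
        ← lintegral_const_mul' _ _ ENNReal.ofReal_ne_top]
      refine (setLIntegral_mono' measurableSet_ball fun h hh => ?_).trans
        (setLIntegral_le_lintegral _ _)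
      exact hκρ z h (by simpa [hB] using hh)
    have hn : ∫⁻ h in B, F (z - h) ≤ ENNReal.ofReal (κ z) * I := by
      rw [← hIρ, ← lintegral_sub_left_eq_self (μ := volume) (fun z => _ * F z) z,
        ← lintegral_const_mul' _ _ ENNReal.ofReal_ne_top]
      refine (setLIntegral_mono' measurableSet_ball fun h hh => ?_).trans
        (setLIntegral_le_lintegral _ _)
      simpa [sub_eq_add_neg] using hκρ z (-h) (by simpa [hB] using hh)
    calc F z * volume B = ∫⁻ h in B, F z := by rw [setLIntegral_const]
      _ ≤ ∫⁻ h in B, (F (z + h) + F (z - h)) := by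
          refine lintegral_mono fun h => ?_
          have h1 := hF (z + h) (z - h) (1 / 2) (1 / 2) (by norm_num) (by norm_num) (by norm_num)
          have h2 : (1 / 2 : ℝ) • (z + h) + (1 / 2 : ℝ) • (z - h) = z := by module
          rw [h2] at h1
          refine h1.trans ((ENNReal.geom_mean_le_arith_mean2_weighted (by norm_num) (by norm_num)
            (by norm_num) _ _).trans ?_)
          have : ENNReal.ofReal (1 / 2) ≤ 1 := by
            rw [← ENNReal.ofReal_one]; exact ENNReal.ofReal_le_ofReal (by norm_num)
          exact add_le_add (mul_le_of_le_one_left' this) (mul_le_of_le_one_left' this)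
      _ = (∫⁻ h in B, F (z + h)) + ∫⁻ h in B, F (z - h) :=
          lintegral_add_left (hm.comp (measurable_const_add z)) _
      _ ≤ _ := by rw [two_mul]; exact add_le_add hp hn
  have hIv : I / volume B ≠ ∞ := ENNReal.div_ne_top hI hBpos
  refine ⟨2 * c * Real.exp 1 * (I / volume B).toReal + 1, by positivity, fun z => ?_⟩
  have h1 := (ENNReal.le_div_iff_mul_le (.inl hBpos) (.inl hBfin)).2 (key z)
  refine h1.trans ?_
  have h2 : (2 : ℝ≥0∞) * (ENNReal.ofReal (κ z) * I) / volume B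
      = ENNReal.ofReal (2 * (κ z * (I / volume B).toReal)) := by
    rw [mul_div_assoc, mul_div_assoc, ENNReal.ofReal_mul zero_le_two,
      ENNReal.ofReal_mul (p := κ z) (by positivity), ENNReal.ofReal_toReal hIv]
    simp
  rw [h2]
  refine ENNReal.ofReal_le_ofReal ?_
  simp only [hκ]
  rw [Real.exp_add]
  nlinarith [Real.exp_pos (‖z‖ ^ 2)]

/-- Finiteness of `ouSemigroup ε f` at `y` is Gaussian integrability of the log-convex function `z ↦
f (a • y + b • z)`; undoing the affine change only alters the constants. -/
theorem ENNReal.LogConvex.exists_log_le {d : ℕ} {ε : ℝ} (hε : 0 < ε)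
    {f : EuclideanSpace ℝ (Fin d) → ℝ≥0∞} (hf : ENNReal.LogConvex f) (hm : Measurable f)
    (h0 : ∀ x, f x ≠ 0) (ht : ∀ x, f x ≠ ∞) {y : EuclideanSpace ℝ (Fin d)}
    (hy : ouSemigroup ε f y ≠ ∞) :
    ∃ C : ℝ, ∀ x, Real.log (f x).toReal ≤ C * (1 + ‖x‖ ^ 2) := by
  set a := Real.exp (-ε / 2)
  set b := Real.sqrt (1 - Real.exp (-ε))
  have hb : 0 < b := exp_ouCoeff_pos hε
  have hF : ENNReal.LogConvex fun z => f (a • y + b • z) := fun z w s t hs ht hst => by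
    refine le_trans (le_of_eq ?_) (hf _ _ s t hs ht hst)
    refine congrArg f ?_
    obtain rfl : s = 1 - t := by linarith
    module
  obtain ⟨C, hC, h⟩ := hF.exists_le_exp_sq (by fun_prop) hy
  refine ⟨|Real.log C| + 2 * (b⁻¹ ^ 2) * (1 + ‖a • y‖ ^ 2), fun x => ?_⟩
  have h1 := h (b⁻¹ • (x - a • y))
  rw [smul_inv_smul₀ hb.ne', add_sub_cancel] at h1
  have h2 : (f x).toReal ≤ C * Real.exp (‖b⁻¹ • (x - a • y)‖ ^ 2) :=
    ENNReal.toReal_le_of_le_ofReal (by positivity) h1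
  have h3 := Real.log_le_log (ENNReal.toReal_pos (h0 x) (ht x)) h2
  rw [Real.log_mul hC.ne' (Real.exp_pos _).ne', Real.log_exp, norm_smul, mul_pow, norm_inv,
    Real.norm_eq_abs, abs_of_pos hb] at h3
  refine h3.trans ?_
  have h4 : ‖x - a • y‖ ^ 2 ≤ 2 * (‖x‖ ^ 2 + ‖a • y‖ ^ 2) := by
    have := pow_le_pow_left₀ (norm_nonneg _) (norm_sub_le x (a • y)) 2
    nlinarith [sq_nonneg (‖x‖ - ‖a • y‖)]
  have h5 : b⁻¹ ^ 2 * ‖x - a • y‖ ^ 2 ≤ b⁻¹ ^ 2 * (2 * (‖x‖ ^ 2 + ‖a • y‖ ^ 2)) := by gcongr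
  have h6 : Real.log C ≤ |Real.log C| := le_abs_self _
  have h7 : 0 ≤ |Real.log C| * ‖x‖ ^ 2 := by positivity
  have h8 : 0 ≤ 2 * b⁻¹ ^ 2 * (1 + ‖a • y‖ ^ 2 * ‖x‖ ^ 2) := by positivity
  nlinarith

/-! ### Relative entropy and optimality of product densities. -/

/-- The negative part of the log-likelihood is integrable. -/
theorem integrable_neg_log_withDensity {Ω : Type*} [MeasurableSpace Ω] {R : Measure Ω}
    [IsFiniteMeasure R] {k : Ω → ℝ} (hk : Measurable k) (hk0 : ∀ p, 0 ≤ k p) :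
    Integrable (fun p => max (-Real.log (k p)) 0) (R.withDensity fun p => ENNReal.ofReal (k p)) := by
  have hm : Measurable fun p => max (-Real.log (k p)) 0 :=
    (Real.measurable_log.comp hk).neg.max measurable_const
  refine ⟨hm.aestronglyMeasurable, ?_⟩
  rw [hasFiniteIntegral_iff_ofReal (f := fun p => max (-Real.log (k p)) 0) (Filter.Eventually.of_forall fun p => le_max_right _ _),
    lintegral_withDensity_eq_lintegral_mul _ (by fun_prop) hm.ennreal_ofReal]
  -- Under `R` the integrand becomes `k · max (-log k) 0`, which is at most `1` since `-k log k ≤ 1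
  -- - k`.
  refine lt_of_le_of_lt (lintegral_mono (g := fun _ => 1) fun p => ?_)
    (by simp [measure_lt_top])
  simp only [Pi.mul_apply]
  rw [← ENNReal.ofReal_mul (hk0 p), ENNReal.ofReal_le_one, mul_max_of_nonneg _ _ (hk0 p)]
  refine max_le ?_ (by simp)
  rcases (hk0 p).eq_or_lt with h | h
  · simp [← h]
  · have := Real.one_sub_inv_le_log_of_pos h
    have h2 := mul_le_mul_of_nonneg_left this h.le
    have h3 : k p * (1 - (k p)⁻¹) = k p - 1 := by field_simp
    linarith

theorem llr_withDensity_ofReal {Ω : Type*} [MeasurableSpace Ω] {R : Measure Ω}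
    [IsProbabilityMeasure R] {k : Ω → ℝ} (hk : Measurable k) (hk0 : ∀ p, 0 ≤ k p) :
    llr (R.withDensity fun p => ENNReal.ofReal (k p)) R =ᵐ[R] fun p => Real.log (k p) := by
  filter_upwards [Measure.rnDeriv_withDensity R (f := fun p => ENNReal.ofReal (k p))
    (by fun_prop)] with p hp
  rw [llr, hp, ENNReal.toReal_ofReal (hk0 p)]

/-- The Pythagorean identity for the relative entropy with respect to a reweighted measure. -/
theorem klDiv_eq_add_of_integral_log_eq {Ω : Type*} [MeasurableSpace Ω] {R π π' : Measure Ω}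
    [IsProbabilityMeasure R] [IsProbabilityMeasure π] [IsProbabilityMeasure π'] {k : Ω → ℝ}
    (hk : Measurable k) (hk0 : ∀ p, 0 ≤ k p)
    (hπ : π = R.withDensity fun p => ENNReal.ofReal (k p)) (hpos : ∀ᵐ p ∂π', 0 < k p)
    (hint : Integrable (fun p => Real.log (k p)) π) (hint' : Integrable (fun p => Real.log (k p)) π')
    (heq : ∫ p, Real.log (k p) ∂π' = ∫ p, Real.log (k p) ∂π) (hfin : klDiv π' R ≠ ∞) :
    klDiv π' R = klDiv π' π + klDiv π R := by
  obtain ⟨hac, hllr⟩ := klDiv_ne_top_iff.1 hfin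
  have hπR : π ≪ R := hπ ▸ withDensity_absolutelyContinuous _ _
  have hll : llr π R =ᵐ[R] fun p => Real.log (k p) := hπ ▸ llr_withDensity_ofReal hk hk0
  -- A `π`-null set is `R`-null apart from its part in `{k = 0}`, and `π'` does not charge `{k =
  -- 0}`.
  have hππ : π' ≪ π := by
    intro s hs
    rw [hπ, withDensity_apply_eq_zero (by fun_prop)] at hs
    refine measure_mono_null (t := ({p | ENNReal.ofReal (k p) ≠ 0} ∩ s) ∪ {p | ¬ 0 < k p}) ?_
      (measure_union_null (hac hs) hpos)
    intro p hp
    by_cases h : 0 < k p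
    · exact .inl ⟨by simpa using h, hp⟩
    · exact .inr h
  have hchain : llr π' R =ᵐ[π'] fun p => llr π' π p + Real.log (k p) := by
    filter_upwards [hac.ae_le (Measure.rnDeriv_mul_rnDeriv hππ (κ := R)), hac.ae_le hll, hpos,
      Measure.rnDeriv_pos hππ, hππ.ae_le (Measure.rnDeriv_ne_top π' π),
      hac.ae_le (Measure.rnDeriv_withDensity R (f := fun p => ENNReal.ofReal (k p)) (by fun_prop))]
      with p h1 h2 h3 h4 h5 h6
    rw [← hπ] at h6
    rw [Pi.mul_apply, h6] at h1
    simp only [llr]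
    rw [← h1, ENNReal.toReal_mul, ENNReal.toReal_ofReal h3.le,
      Real.log_mul (ENNReal.toReal_pos h4.ne' h5).ne' h3.ne']
  have hint1 : Integrable (llr π' π) π' := by
    refine (hllr.sub hint').congr (hchain.mono fun p hp => ?_)
    simp only [Pi.sub_apply, hp, add_sub_cancel_right]
  have hint2 : Integrable (llr π R) π := hint.congr (Filter.EventuallyEq.symm (hπR.ae_le hll))
  have n1 : klDiv π' π ≠ ∞ := klDiv_ne_top hππ hint1
  have n2 : klDiv π R ≠ ∞ := klDiv_ne_top hπR hint2
  rw [← ENNReal.toReal_eq_toReal_iff' hfin (ENNReal.add_ne_top.2 ⟨n1, n2⟩),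
    ENNReal.toReal_add n1 n2, toReal_klDiv_of_measure_eq hac (by simp),
    toReal_klDiv_of_measure_eq hππ (by simp), toReal_klDiv_of_measure_eq hπR (by simp),
    integral_congr_ae hchain, integral_add hint1 hint', heq, integral_congr_ae (hπR.ae_le hll)]

theorem isProbabilityMeasure_of_isCouplingOf {X Y : Type*} [MeasurableSpace X] [MeasurableSpace Y]
    {μ : Measure X} {ν : Measure Y} [IsProbabilityMeasure μ] {π : Measure (X × Y)}
    (h : IsCouplingOf μ ν π) : IsProbabilityMeasure π := by
  refine ⟨?_⟩
  have := measure_univ (μ := μ)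
  rwa [← h.1, Measure.map_apply measurable_fst .univ, Set.preimage_univ] at this

theorem integrable_comp_fst_add_comp_snd {X Y : Type*} [MeasurableSpace X] [MeasurableSpace Y]
    {μ : Measure X} {ν : Measure Y} {π : Measure (X × Y)} (h : IsCouplingOf μ ν π)
    {a : X → ℝ} {b : Y → ℝ} (ha : Integrable a μ) (hb : Integrable b ν) :
    Integrable (fun p => a p.1 + b p.2) π ∧
      ∫ p, (a p.1 + b p.2) ∂π = ∫ x, a x ∂μ + ∫ y, b y ∂ν := by
  have ha' := ha
  have hb' := hb
  rw [← h.1] at ha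
  rw [← h.2] at hb
  have i1 : Integrable (fun p : X × Y => a p.1) π := ha.comp_measurable measurable_fst
  have i2 : Integrable (fun p : X × Y => b p.2) π := hb.comp_measurable measurable_snd
  refine ⟨i1.add i2, ?_⟩
  rw [integral_add i1 i2]
  conv_rhs => rw [← h.1, ← h.2]
  rw [integral_map measurable_fst.aemeasurable ha.aestronglyMeasurable,
    integral_map measurable_snd.aemeasurable hb.aestronglyMeasurable]

/-- A coupling whose density with respect to the reference measure is a product `f(x) g(y)` with
integrable logarithms is the unique optimal entropic coupling. -/
theorem optimal_of_product_density {d : ℕ} {ε : ℝ} {μ ν : Measure (EuclideanSpace ℝ (Fin d))}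
    [IsProbabilityMeasure μ] {f g : EuclideanSpace ℝ (Fin d) → ℝ} (hf : Measurable f)
    (hg : Measurable g) (hf0 : ∀ x, 0 < f x) (hg0 : ∀ y, 0 ≤ g y) (hgpos : ∀ᵐ y ∂ν, 0 < g y)
    (hfi : Integrable (fun x => Real.log (f x)) μ) (hgi : Integrable (fun y => Real.log (g y)) ν)
    {π : Measure (EuclideanSpace ℝ (Fin d) × EuclideanSpace ℝ (Fin d))}
    (hπ : π = (ouJointLaw d ε).withDensity fun p => ENNReal.ofReal (f p.1 * g p.2))
    (hc : IsCouplingOf μ ν π) :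
    IsOptimalEntropicCoupling ε μ ν π ∧ (∀ π', IsOptimalEntropicCoupling ε μ ν π' → π' = π) ∧
      (klDiv π (ouJointLaw d ε) : EReal) =
        ((∫ x, Real.log (f x) ∂μ + ∫ y, Real.log (g y) ∂ν : ℝ) : EReal) := by
  have pπ := isProbabilityMeasure_of_isCouplingOf hc
  have hk : Measurable fun p : EuclideanSpace ℝ (Fin d) × EuclideanSpace ℝ (Fin d) =>
    f p.1 * g p.2 := by fun_prop
  have hk0 : ∀ p : EuclideanSpace ℝ (Fin d) × EuclideanSpace ℝ (Fin d), 0 ≤ f p.1 * g p.2 :=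
    fun p => mul_nonneg (hf0 _).le (hg0 _)
  -- The logarithm of the density splits into a function of `x` plus a function of `y`, so its
  -- integral depends only on the marginals.
  have cpl : ∀ π' : Measure (EuclideanSpace ℝ (Fin d) × EuclideanSpace ℝ (Fin d)),
      IsCouplingOf μ ν π' → (∀ᵐ p ∂π', 0 < f p.1 * g p.2) ∧
        Integrable (fun p => Real.log (f p.1 * g p.2)) π' ∧
        ∫ p, Real.log (f p.1 * g p.2) ∂π' = ∫ x, Real.log (f x) ∂μ + ∫ y, Real.log (g y) ∂ν := by
    intro π' h'
    have h1 : ∀ᵐ p ∂π', 0 < g p.2 := by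
      rw [← h'.2] at hgpos
      exact ae_of_ae_map measurable_snd.aemeasurable hgpos
    have h2 : (fun p => Real.log (f p.1) + Real.log (g p.2)) =ᵐ[π']
        fun p => Real.log (f p.1 * g p.2) :=
      h1.mono fun p hp => (Real.log_mul (hf0 _).ne' hp.ne').symm
    have h3 := integrable_comp_fst_add_comp_snd h' hfi hgi
    exact ⟨h1.mono fun p hp => mul_pos (hf0 _) hp, h3.1.congr h2,
      (integral_congr_ae h2).symm.trans h3.2⟩
  obtain ⟨-, hint, hval⟩ := cpl π hc
  have hac : π ≪ ouJointLaw d ε := hπ ▸ withDensity_absolutelyContinuous _ _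
  have hll : llr π (ouJointLaw d ε) =ᵐ[π] fun p => Real.log (f p.1 * g p.2) :=
    hac.ae_le (hπ ▸ llr_withDensity_ofReal hk hk0)
  have hint2 : Integrable (llr π (ouJointLaw d ε)) π := hint.congr hll.symm
  have hfin : klDiv π (ouJointLaw d ε) ≠ ∞ := klDiv_ne_top hac hint2
  have pyth : ∀ π', IsCouplingOf μ ν π' → klDiv π' (ouJointLaw d ε) ≠ ∞ →
      klDiv π' (ouJointLaw d ε) = klDiv π' π + klDiv π (ouJointLaw d ε) := by
    intro π' h' hfin'
    have pπ' := isProbabilityMeasure_of_isCouplingOf h'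
    obtain ⟨hpos', hint', hval'⟩ := cpl π' h'
    exact klDiv_eq_add_of_integral_log_eq hk hk0 hπ hpos' hint hint' (hval'.trans hval.symm) hfin'
  have hopt : klDiv π (ouJointLaw d ε) = entropicCost ε μ ν := by
    refine le_antisymm (le_iInf₂ fun π' h' => ?_) (iInf₂_le π hc)
    by_cases hfin' : klDiv π' (ouJointLaw d ε) = ∞
    · rw [hfin']; exact le_top
    · rw [pyth π' h' hfin']; exact le_add_self
  refine ⟨⟨hc, hopt⟩, fun π' ⟨h', ho⟩ => ?_, ?_⟩
  · have pπ' := isProbabilityMeasure_of_isCouplingOf h'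
    rw [← hopt] at ho
    have h1 := pyth π' h' (ho ▸ hfin)
    rw [ho] at h1
    have h2 : klDiv π' π = 0 := by
      have h3 : 0 + klDiv π (ouJointLaw d ε) = klDiv π' π + klDiv π (ouJointLaw d ε) := by
        rw [zero_add]; exact h1
      exact ((ENNReal.add_left_inj hfin).1 h3).symm
    exact klDiv_eq_zero_iff.1 h2
  · rw [← ENNReal.ofReal_toReal hfin, EReal.coe_ennreal_ofReal,
      toReal_klDiv_of_measure_eq hac (by simp), max_eq_left, integral_congr_ae hll, hval]
    rw [← toReal_klDiv_of_measure_eq hac (by simp)]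
    exact ENNReal.toReal_nonneg

/-- Integrating out `y` produces `f · P g`; integrating out `x` produces `g · P f`, by
reversibility. -/
theorem isCouplingOf_withDensity_ouJointLaw {d : ℕ} {ε : ℝ} (hε : 0 < ε)
    {f g e u : EuclideanSpace ℝ (Fin d) → ℝ≥0∞} (hf : Measurable f) (hg : Measurable g)
    (hfe : ∀ᵐ x ∂(stdGaussian (EuclideanSpace ℝ (Fin d))), f x * ouSemigroup ε g x = e x)
    (hgu : ∀ᵐ y ∂(stdGaussian (EuclideanSpace ℝ (Fin d))), g y * ouSemigroup ε f y = u y) :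
    IsCouplingOf ((stdGaussian (EuclideanSpace ℝ (Fin d))).withDensity e)
      ((stdGaussian (EuclideanSpace ℝ (Fin d))).withDensity u)
      ((ouJointLaw d ε).withDensity fun p => f p.1 * g p.2) := by
  constructor
  · ext s hs
    rw [Measure.map_apply measurable_fst hs, withDensity_apply _ (measurable_fst hs),
      withDensity_apply _ hs, ← lintegral_indicator (measurable_fst hs), ← lintegral_indicator hs]
    calc _ = ∫⁻ p, s.indicator f p.1 * g p.2 ∂(ouJointLaw d ε) := by
          refine lintegral_congr fun p => ?_
          by_cases hp : p.1 ∈ s <;> simp [Set.indicator, hp]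
      _ = _ := by
          rw [lintegral_mul_ouJointLaw (hf.indicator hs) hg]
          refine lintegral_congr_ae (hfe.mono fun x hx => ?_)
          by_cases hp : x ∈ s <;> simp [Set.indicator, hp, hx]
  · ext s hs
    rw [Measure.map_apply measurable_snd hs, withDensity_apply _ (measurable_snd hs),
      withDensity_apply _ hs, ← lintegral_indicator (measurable_snd hs), ← lintegral_indicator hs]
    calc _ = ∫⁻ p, f p.1 * s.indicator g p.2 ∂(ouJointLaw d ε) := by
          refine lintegral_congr fun p => ?_
          by_cases hp : p.2 ∈ s <;> simp [Set.indicator, hp]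
      _ = _ := by
          rw [lintegral_mul_ouJointLaw' hε hf (hg.indicator hs)]
          refine lintegral_congr_ae (hgu.mono fun x hx => ?_)
          by_cases hp : x ∈ s <;> simp [Set.indicator, hp, hx]

/-- Integrability of the logarithm of the second potential, given that of the first one. -/
theorem integrable_log_snd_of_product_density {X Y : Type*} [MeasurableSpace X] [MeasurableSpace Y]
    {μ : Measure X} {ν : Measure Y} {R π : Measure (X × Y)} [IsFiniteMeasure R] [IsFiniteMeasure π]
    (hc : IsCouplingOf μ ν π) {f : X → ℝ} {g : Y → ℝ} (hf : Measurable f) (hg : Measurable g)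
    (hf1 : ∀ x, 1 ≤ f x) (hg0 : ∀ y, 0 ≤ g y) (hgpos : ∀ᵐ y ∂ν, 0 < g y) {M : ℝ}
    (hgM : ∀ y, g y ≤ M) (hπ : π = R.withDensity fun p => ENNReal.ofReal (f p.1 * g p.2))
    (hfi : Integrable (fun x => Real.log (f x)) μ) : Integrable (fun y => Real.log (g y)) ν := by
  have hlg : Measurable fun y => Real.log (g y) := Real.measurable_log.comp hg
  -- Lifted to `π`, `-log g = log f - log (f g)` is at most `log f` plus the negative part of `log
  -- (f g)`, both integrable, while `log g ≤ |log M|` controls the other sign.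
  have i1 := integrable_neg_log_withDensity (R := R) (k := fun p : X × Y => f p.1 * g p.2)
    (by fun_prop) fun p => mul_nonneg (zero_le_one.trans (hf1 _)) (hg0 _)
  rw [← hπ] at i1
  rw [← hc.1] at hfi
  have i2 : Integrable (fun p : X × Y => Real.log (f p.1)) π := hfi.comp_measurable measurable_fst
  rw [← hc.2] at hgpos ⊢
  rw [integrable_map_measure hlg.aestronglyMeasurable measurable_snd.aemeasurable]
  refine ((i1.add i2).add (integrable_const |Real.log M|)).mono'
    (hlg.comp measurable_snd).aestronglyMeasurable ?_
  filter_upwards [ae_of_ae_map measurable_snd.aemeasurable hgpos] with p hp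
  simp only [Function.comp, Real.norm_eq_abs, Pi.add_apply]
  have hfp : 0 < f p.1 := one_pos.trans_le (hf1 _)
  have h1 := Real.log_mul hfp.ne' hp.ne'
  have h2 := le_max_left (-Real.log (f p.1 * g p.2)) 0
  have h3 := le_max_right (-Real.log (f p.1 * g p.2)) 0
  have h4 := Real.log_nonneg (hf1 p.1)
  have h5 := Real.log_le_log hp (hgM p.2)
  have h6 := le_abs_self (Real.log M)
  have h7 := abs_nonneg (Real.log M)
  rw [abs_le]
  constructor <;> linarith

/-! ### From the Schrödinger system to the theorem. -/

theorem ENNReal.LogConvex.ofReal_exp {E : Type*} [AddCommGroup E] [Module ℝ E] {v : E → ℝ}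
    (hv : ConvexOn ℝ Set.univ v) : ENNReal.LogConvex fun x => ENNReal.ofReal (Real.exp (v x)) := by
  intro x y s t hs ht hst
  rw [ENNReal.ofReal_rpow_of_pos (Real.exp_pos _), ENNReal.ofReal_rpow_of_pos (Real.exp_pos _),
    ← ENNReal.ofReal_mul (by positivity), ← Real.exp_mul, ← Real.exp_mul, ← Real.exp_add]
  refine ENNReal.ofReal_le_ofReal (Real.exp_le_exp.2 ?_)
  have := hv.2 (Set.mem_univ x) (Set.mem_univ y) hs.le ht.le hst
  simp only [smul_eq_mul] at this
  linarith

theorem ENNReal.LogConcave.isLogConcave_toReal {E : Type*} [AddCommGroup E] [Module ℝ E]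
    {φ : E → ℝ≥0∞} (hφ : ENNReal.LogConcave φ) (ht : ∀ x, φ x ≠ ∞) :
    IsLogConcave fun x => (φ x).toReal := by
  refine ⟨fun x => ENNReal.toReal_nonneg, fun x y a b ha hb hab => ?_⟩
  have h := ENNReal.toReal_mono (ht _) (hφ x y a b ha hb hab)
  rwa [ENNReal.toReal_mul, ← ENNReal.toReal_rpow, ← ENNReal.toReal_rpow] at h

theorem mainTheorem3 (d : ℕ) (ε : ℝ) (hε : 0 < ε)
    (V W : EuclideanSpace ℝ (Fin d) → EReal)
    (μ ν : Measure (EuclideanSpace ℝ (Fin d)))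
    [IsProbabilityMeasure μ] [IsProbabilityMeasure ν]
    (hV : IsConvexExtended V) (hW : IsConvexExtended W)
    (hVbdd : ∃ m : ℝ, ∀ x, (m : EReal) ≤ V x)
    (hμ : μ = (stdGaussian (EuclideanSpace ℝ (Fin d))).withDensity (fun x => EReal.exp (V x)))
    (hν : ν = (stdGaussian (EuclideanSpace ℝ (Fin d))).withDensity (fun x => EReal.exp (-W x)))
    (hμ2 : Integrable (fun x => ‖x‖ ^ 2) μ)
    (hνc : IsCompact ν.support) :
    ∃ π : Measure (EuclideanSpace ℝ (Fin d) × EuclideanSpace ℝ (Fin d)),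
      IsOptimalEntropicCoupling ε μ ν π ∧
      (∀ π', IsOptimalEntropicCoupling ε μ ν π' → π' = π) ∧
      ∃ f g : EuclideanSpace ℝ (Fin d) → ℝ,
        Measurable f ∧ Measurable g ∧
        (∀ x, 1 ≤ f x) ∧ IsLogConvex f ∧ IsLogConcave g ∧
        π = (ouJointLaw d ε).withDensity (fun p => ENNReal.ofReal (f p.1 * g p.2)) ∧
        Integrable (fun x => Real.log (f x)) μ ∧
        (∀ᵐ y ∂ν, 0 < g y) ∧ Integrable (fun y => Real.log (g y)) ν ∧
        (entropicCost ε μ ν : EReal) = (klDiv π (ouJointLaw d ε) : EReal) ∧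
        (klDiv π (ouJointLaw d ε) : EReal) =
          ((∫ x, Real.log (f x) ∂μ + ∫ y, Real.log (g y) ∂ν : ℝ) : EReal) := by
  obtain ⟨u, um, uc, ⟨M, hM, huM⟩, us, hνu⟩ := hW.exists_logConcave_density hν hνc
  obtain ⟨v, hv, hVv⟩ : ∃ v : EuclideanSpace ℝ (Fin d) → ℝ,
      ConvexOn ℝ Set.univ v ∧ ∀ x, V x = v x := by
    have : IsProbabilityMeasure ((stdGaussian (EuclideanSpace ℝ (Fin d))).withDensity
      fun x => EReal.exp (V x)) := hμ ▸ inferInstance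
    exact hV.exists_convexOn_of_isProbabilityMeasure
  obtain ⟨m, hm⟩ := hVbdd
  set e : EuclideanSpace ℝ (Fin d) → ℝ≥0∞ := fun x => ENNReal.ofReal (Real.exp (v x)) with he
  have hμe : μ = (stdGaussian (EuclideanSpace ℝ (Fin d))).withDensity e := by
    rw [hμ]; congr 1; ext1 x; rw [hVv, EReal.exp_coe]
  have mass : ∀ (ρ : Measure (EuclideanSpace ℝ (Fin d))) [IsProbabilityMeasure ρ]
      (w : EuclideanSpace ℝ (Fin d) → ℝ≥0∞),
      ρ = (stdGaussian (EuclideanSpace ℝ (Fin d))).withDensity w →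
      ∫⁻ x, w x ∂(stdGaussian (EuclideanSpace ℝ (Fin d))) = 1 := fun ρ _ w h => by
    rw [← measure_univ (μ := ρ), h, withDensity_apply _ .univ, Measure.restrict_univ]
  have hS : SchrodingerData e u :=
    { measurable_fst := (Real.continuous_exp.comp
        hv.locallyLipschitz.continuous).measurable.ennreal_ofReal
      logConvex_fst := .ofReal_exp hv
      fst_ne_top := fun x => ENNReal.ofReal_ne_top
      fst_lower := ⟨ENNReal.ofReal (Real.exp m), by simpa using Real.exp_pos m, fun x =>
        ENNReal.ofReal_le_ofReal (Real.exp_le_exp.2 (by exact_mod_cast hVv x ▸ hm x))⟩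
      lintegral_fst := mass μ e hμe
      measurable_snd := um
      logConcave_snd := uc
      snd_upper := ⟨ENNReal.ofReal M, ENNReal.ofReal_ne_top, huM⟩
      snd_compact := ⟨ν.support, hνc, us⟩
      lintegral_snd := mass ν u hνu }
  obtain ⟨f, hf, hfe⟩ := hS.exists_solution hε
  have hft := hS.iterate_ne_top hε hf
  have hf0 : ∀ x, f x ≠ 0 := fun x => (one_pos.trans_le (hf.one_le x)).ne'
  have hPf0 := ouSemigroup_ne_zero_of_one_le (ε := ε) hf.one_le
  set g := schrodingerDual ε u f with hg
  have gm : Measurable g := um.schrodingerDual hf.measurable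
  have hgM : ∀ y, g y ≤ ENNReal.ofReal M := fun y => (schrodingerDual_le hf.one_le y).trans (huM y)
  have hgt : ∀ y, g y ≠ ∞ := fun y => ne_top_of_le_ne_top ENNReal.ofReal_ne_top (hgM y)
  have hgu : ∀ᵐ y ∂(stdGaussian (EuclideanSpace ℝ (Fin d))), g y * ouSemigroup ε f y = u y := by
    filter_upwards [hf.ae_ne_top] with y hy
    by_cases h0 : u y = 0
    · simp [hg, schrodingerDual, h0]
    · exact ENNReal.div_mul_cancel (hPf0 y) (hy h0)
  have hdens : ∀ p : EuclideanSpace ℝ (Fin d) × EuclideanSpace ℝ (Fin d),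
      ENNReal.ofReal ((f p.1).toReal * (g p.2).toReal) = f p.1 * g p.2 := fun p => by
    rw [← ENNReal.toReal_mul, ENNReal.ofReal_toReal (ENNReal.mul_ne_top (hft _) (hgt _))]
  set π := (ouJointLaw d ε).withDensity
    fun p => ENNReal.ofReal ((f p.1).toReal * (g p.2).toReal) with hπ
  have hc : IsCouplingOf μ ν π := by
    rw [hπ, hμe, hνu]
    simp only [hdens]
    exact isCouplingOf_withDensity_ouJointLaw hε hf.measurable gm hfe hgu
  have pπ := isProbabilityMeasure_of_isCouplingOf hc
  have hf1 : ∀ x, 1 ≤ (f x).toReal := fun x => by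
    simpa using ENNReal.toReal_mono (hft x) (hf.one_le x)
  have hfr : Measurable fun x => (f x).toReal := hf.measurable.ennreal_toReal
  have hgr : Measurable fun y => (g y).toReal := gm.ennreal_toReal
  have hgpos : ∀ᵐ y ∂ν, 0 < (g y).toReal := by
    rw [hνu, ae_withDensity_iff um]
    filter_upwards [hgu] with y hy h0
    exact ENNReal.toReal_pos (fun h => h0 (by rw [← hy, h, zero_mul])) (hgt y)
  have hfi : Integrable (fun x => Real.log (f x).toReal) μ := by
    -- The growth bound needs one point where the semigroup of `f` is finite. Since `f ≥ 1`, the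
    -- logarithm is nonnegative and this upper bound with the second moment of `μ` suffices.
    obtain ⟨y, -, hy⟩ := hS.exists_of_ae hf.ae_ne_top
    obtain ⟨C, hC⟩ := hf.logConvex.exists_log_le hε hf.measurable hf0 hft hy
    refine (((integrable_const 1).add hμ2).const_mul C).mono'
      (Real.measurable_log.comp hfr).aestronglyMeasurable (.of_forall fun x => ?_)
    rw [Real.norm_eq_abs, abs_of_nonneg (Real.log_nonneg (hf1 x))]
    exact hC x
  have hgi : Integrable (fun y => Real.log (g y).toReal) ν :=
    integrable_log_snd_of_product_density hc hfr hgr hf1 (fun y => ENNReal.toReal_nonneg) hgpos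
      (fun y => ENNReal.toReal_le_of_le_ofReal hM.le (hgM y)) hπ hfi
  obtain ⟨hopt, huniq, hval⟩ := optimal_of_product_density hfr hgr
    (fun x => one_pos.trans_le (hf1 x)) (fun y => ENNReal.toReal_nonneg) hgpos hfi hgi hπ hc
  refine ⟨π, hopt, huniq, fun x => (f x).toReal, fun y => (g y).toReal, hfr, hgr, hf1,
    ⟨fun x => one_pos.trans_le (hf1 x), hf.logConvex.convexOn_log hf0 hft⟩, ?_, hπ, hfi, hgpos, hgi,
    by rw [hopt.2], hval⟩
  exact (logConcave_schrodingerDual uc hf.measurable hf.one_le hf.logConvex).isLogConcave_toReal hgt
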